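/- Proposition. A piston of mass $M$ moves on the line in an ideal gas of atoms of mass $m$, $0<m<M$. The gas to the left (right) of the piston has spatial density $n_->0$ ($n_+>0$) and velocity density $f_-$ ($f_+$), where $f_\pm$ are even probability densities vanishing unless $v_{\min}<|v|<v_{\max}$, with $0<v_{\min}<v_{\max}<\infty$. Put $p_\pm=n_\pm f_\pm$ and fix $\bar V$ with $0<\bar V<\frac{M-m}{3M+m}v_{\min}$. Let $W(t)$ be the time-homogeneous Markov jump process on $[-\bar V,\bar V]$ in which a piston of velocity $u$ is hit by an atom of velocity $v>0$ at rate $(v-u)\,p_-(v)\,dv$ and by an atom of velocity $v<0$ at rate $(u-v)\,p_+(v)\,dv$; at a hit the velocity jumps to $V'=\frac{M-m}{M+m}u+\frac{2m}{M+m}v$, replaced by $2\bar V-V'$ if $V'>\bar V$ and by $-2\bar V-V'$ if $V'<-\bar V$. Assume that a single reflection always returns the velocity to $[-\bar V,\bar V]$, namely $\frac{M-m}{M+m}\bar V+\frac{2m}{M+m}v_{\max}\le 3\bar V$ (true for $M/m$ large). Then $W(t)$ has a unique stationary probability measure $\mu_0$ on $[-\bar V,\bar V]$, and $\mu_0$ is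 absolutely continuous: $d\mu_0=f_0\,dw$ on $(-\bar V,\bar V)$. If moreover the piston is so heavy that $2m\,v_{\max}\le (M-m)\bar V$, then there is $c_0>0$ with $f_0\ge c_0$ on $(-\bar V,\bar V)$. Finally, there are constants $C,\gamma>0$ such that for every initial probability distribution $\nu$ on $[-\bar V,\bar V]$, the distribution $\nu_t$ of $W(t)$ when $W(0)\sim\nu$ satisfies $$\sup_{A}|\nu_t(A)-\mu_0(A)|\le C e^{-\gamma t}\qquad(t\ge 0),$$ the supremum being over all Borel sets $A\subset\mathbb R$. -/

import Mathlib

open MeasureTheory Set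
open scoped ENNReal

noncomputable section

/-- A heavy piston (mass `M`) in a one-dimensional ideal gas of atoms of mass `m`.  The gas on the
left (right) of the piston has spatial density `nL` (`nR`) and velocity density `fL` (`fR`); both
velocity densities are even and vanish unless `vmin < |v| < vmax`.  The speed of the piston is
kept at most `Vbar` by reflection, where `Vbar` is less than `(M - m) / (3 M + m) * vmin`. -/
structure PistonModel where
  m : ℝ
  M : ℝ
  vmin : ℝ
  vmax : ℝ
  Vbar : ℝ
  nL : ℝ
  nR : ℝ
  fL : ℝ → ℝ
  fR : ℝ → ℝ
  m_pos : 0 < m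
  m_lt_M : m < M
  vmin_pos : 0 < vmin
  vmin_lt_vmax : vmin < vmax
  Vbar_pos : 0 < Vbar
  Vbar_lt : Vbar < (M - m) / (3 * M + m) * vmin
  nL_pos : 0 < nL
  nR_pos : 0 < nR
  fL_measurable : Measurable fL
  fR_measurable : Measurable fR
  fL_nonneg : ∀ v, 0 ≤ fL v
  fR_nonneg : ∀ v, 0 ≤ fR v
  fL_even : ∀ v, fL (-v) = fL v
  fR_even : ∀ v, fR (-v) = fR v
  fL_prob : ∫⁻ v, ENNReal.ofReal (fL v) = 1
  fR_prob : ∫⁻ v, ENNReal.ofReal (fR v) = 1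
  fL_cutoff : ∀ v, |v| ≤ vmin ∨ vmax ≤ |v| → fL v = 0
  fR_cutoff : ∀ v, |v| ≤ vmin ∨ vmax ≤ |v| → fR v = 0

namespace PistonModel

variable (G : PistonModel)

/-- The state space `[-Vbar, Vbar]` of the process. -/
def states : Set ℝ := Icc (-G.Vbar) G.Vbar

/-- Velocity of the piston after an elastic collision with an atom of velocity `v`. -/
def collide (u v : ℝ) : ℝ :=
  (G.M - G.m) / (G.M + G.m) * u + 2 * G.m / (G.M + G.m) * v

/-- Reflection at `± Vbar`. -/
def reflect (w : ℝ) : ℝ :=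
  if G.Vbar < w then 2 * G.Vbar - w
  else if w < -G.Vbar then -2 * G.Vbar - w
  else w

/-- Velocity of the piston after a collision followed by the reflection rule. -/
def jump (u v : ℝ) : ℝ := G.reflect (G.collide u v)

/-- Rate, per unit time and per `dv`, of collisions of a piston of velocity `u` with atoms of
velocity `v`: atoms on the left arrive with `v > 0` and relative speed `v - u`, atoms on the right
arrive with `v < 0` and relative speed `u - v`. -/
def rate (u v : ℝ) : ℝ≥0∞ :=
  if 0 < v then ENNReal.ofReal ((v - u) * (G.nL * G.fL v))
  else ENNReal.ofReal ((u - v) * (G.nR * G.fR v))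

/-- Total collision rate of a piston of velocity `u`. -/
def totalRate (u : ℝ) : ℝ := (∫⁻ v, G.rate u v).toReal

/-- `G.transN n t u A` is the probability that the piston, started with velocity `u`, undergoes
exactly `n` collisions during the time `t` and has its velocity in `A` at time `t`.  With no
collision the velocity stays `u`, which has probability `exp (-t * totalRate u)`; otherwise one
conditions on the time `s` of the first collision and on the velocity `v` of the atom hit. -/
def transN : ℕ → ℝ → ℝ → Set ℝ → ℝ≥0∞
  | 0, t, u, A => ENNReal.ofReal (Real.exp (-G.totalRate u * t)) * A.indicator 1 u
  | n + 1, t, u, A =>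
      ∫⁻ s in Ioc 0 t, ENNReal.ofReal (Real.exp (-G.totalRate u * s)) *
        ∫⁻ v, G.rate u v * transN n (t - s) (G.jump u v) A

/-- Transition probability `P (W (s + t) ∈ A | W s = u)` of the jump process `W`. -/
def trans (t u : ℝ) (A : Set ℝ) : ℝ≥0∞ := ∑' n, G.transN n t u A

/-- The distribution at time `t` of `W` when its initial distribution is `ν`. -/
def evolve (ν : Measure ℝ) (t : ℝ) (A : Set ℝ) : ℝ≥0∞ := ∫⁻ u, G.trans t u A ∂ν

/-- `ν` is a probability distribution on the state space `[-Vbar, Vbar]`. -/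
def IsDistribution (ν : Measure ℝ) : Prop := IsProbabilityMeasure ν ∧ ν G.statesᶜ = 0

/-- `μ` is a stationary measure of the process `W`. -/
def IsStationary (μ : Measure ℝ) : Prop :=
  G.IsDistribution μ ∧ ∀ t, 0 ≤ t → ∀ A, MeasurableSet A → G.evolve μ t A = μ A

/-- `W` is a version of the reflected velocity of the piston on the probability space `(Ω, ℙ)`:
a Markov process on `[0, ∞)` with the above transition probabilities, started in
`[-Vbar, Vbar]`, with right-continuous piecewise constant trajectories. -/
structure IsPistonVelocity {Ω : Type*} [MeasurableSpace Ω] (ℙ : Measure Ω) (W : ℝ → Ω → ℝ) :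
    Prop where
  measurable : ∀ t, 0 ≤ t → Measurable (W t)
  start : ∀ᵐ ω ∂ℙ, W 0 ω ∈ G.states
  markov : ∀ s t, 0 ≤ s → 0 ≤ t → ∀ A, MeasurableSet A → ∀ B,
    MeasurableSet[⨆ r ∈ Icc 0 s, MeasurableSpace.comap (W r) inferInstance] B →
      ℙ (B ∩ W (s + t) ⁻¹' A) = ∫⁻ ω in B, G.trans t (W s ω) A ∂ℙ
  step : ∀ᵐ ω ∂ℙ, ∀ t, 0 ≤ t → ∃ δ > 0, (∀ r ∈ Ico t (t + δ), W r ω = W t ω) ∧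
    ∃ c, ∀ r ∈ Ioo (t - δ) t, 0 ≤ r → W r ω = c

end PistonModel

end

/-! Convergence is a Doeblin argument. A collision contracts piston velocities by `keep` =
(M-m)/(M+m) < 1, and reflection is 1-Lipschitz, so two pistons hit by the same atom come closer by
that factor. Two close pistons can be brought to the same velocity by slightly different atoms,
because the atoms have a density. A compact "core" K of atom velocities with rates bounded below on
all states makes this quantitative: after finitely many collisions any two starting points have laws
with a common part of mass ε (`exists_overlap`). Hence the oscillation over the states of the
expectation of a test function shrinks by 1-ε in a fixed time (`expect_le_expect_add`) and decays
exponentially (`exists_mixing`).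

The decay is uniform over test functions with values in [0,1], so the limits of the probabilities
are countably additive in the set. They form the stationary measure; uniqueness and the rate for
arbitrary initial laws follow at once.

Any stationary μ is absolutely continuous: once a collision has occurred the law does not charge
Lebesgue null sets, so μ(A) ≤ e^{-r} μ(A) for null A, where r > 0 bounds the collision rate from
below.

For the lower bound on the density of a heavy piston, let U be the complement of the support. By
stationarity U contains its preimages under the jump maps of some upward and some downward kick.
Preimages stretch intervals by 1/`keep`, so an interval of states in U would grow until U contained
all interior states, which is absurd (`BackwardInvariant.Ioo_subset`, `Ioo_subset_support`). Full
support and lower semicontinuity of translates give that μ-null sets of interior states are Lebesgue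
null. Then the mass of the velocities from which y is reached by a core atom is positive and lower
semicontinuous in y, hence bounded below on each of the compact halves of the state space, and it
bounds the density at y from below up to a factor (`exists_smul_volume_le`). -/

noncomputable section

/-! ### Geometry of collisions and reflection -/

namespace PistonModel

variable (G : PistonModel)

/-- The weight of the velocity of the piston in an elastic collision. -/
def keep : ℝ := (G.M - G.m) / (G.M + G.m)

/-- The weight of the velocity of the atom in an elastic collision. -/
def kick : ℝ := 2 * G.m / (G.M + G.m)

theorem collide_eq (u v : ℝ) : G.collide u v = G.keep * u + G.kick * v := rfl

theorem keep_pos : 0 < G.keep :=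
  div_pos (sub_pos.2 G.m_lt_M) (add_pos (G.m_pos.trans G.m_lt_M) G.m_pos)

theorem kick_pos : 0 < G.kick :=
  div_pos (mul_pos two_pos G.m_pos) (add_pos (G.m_pos.trans G.m_lt_M) G.m_pos)

theorem keep_add_kick : G.keep + G.kick = 1 := by
  have h : G.M + G.m ≠ 0 := (add_pos (G.m_pos.trans G.m_lt_M) G.m_pos).ne'
  unfold keep kick
  field_simp
  ring

theorem keep_lt_one : G.keep < 1 := by
  linarith [G.keep_add_kick, G.kick_pos]

/-- Every atom is faster than the piston, so relative speeds of approach are bounded below by the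
positive number `vmin - Vbar`. -/
theorem Vbar_lt_vmin : G.Vbar < G.vmin := by
  refine G.Vbar_lt.trans_le (mul_le_of_le_one_left G.vmin_pos.le ?_)
  have h1 := G.m_pos
  have h2 := G.m_lt_M
  rw [div_le_one (by linarith)]
  linarith

theorem reflect_eq (w : ℝ) :
    G.reflect w = w - 2 * max (w - G.Vbar) 0 + 2 * max (-G.Vbar - w) 0 := by
  have h := G.Vbar_pos
  unfold reflect
  split_ifs with h1 h2
  · rw [max_eq_left (by linarith), max_eq_right (by linarith)]; ring
  · rw [max_eq_right (by linarith), max_eq_left (by linarith)]; ring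
  · rw [max_eq_right (by linarith), max_eq_right (by linarith)]; ring

theorem continuous_reflect : Continuous G.reflect := by
  have : G.reflect = fun w => w - 2 * max (w - G.Vbar) 0 + 2 * max (-G.Vbar - w) 0 :=
    funext G.reflect_eq
  rw [this]
  fun_prop

theorem reflect_of_mem {w : ℝ} (h1 : -G.Vbar ≤ w) (h2 : w ≤ G.Vbar) : G.reflect w = w := by
  unfold reflect
  rw [if_neg (not_lt.2 h2), if_neg (not_lt.2 h1)]

theorem reflect_of_lt {w : ℝ} (h : w < -G.Vbar) : G.reflect w = -2 * G.Vbar - w := by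
  have := G.Vbar_pos
  unfold reflect
  rw [if_neg (by linarith), if_pos h]

theorem reflect_neg (w : ℝ) : G.reflect (-w) = -G.reflect w := by
  rw [reflect_eq, reflect_eq, show -w - G.Vbar = -G.Vbar - w by ring,
    show -G.Vbar - -w = w - G.Vbar by ring]
  ring

theorem abs_reflect_sub_le (w w' : ℝ) : |G.reflect w - G.reflect w'| ≤ |w - w'| := by
  have h := G.Vbar_pos
  unfold reflect
  rcases abs_cases (w - w') with ⟨e, _⟩ | ⟨e, _⟩ <;> rw [e, abs_le] <;> split_ifs <;>
    constructor <;> linarith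

theorem reflect_mem_states {w : ℝ} (hw : |w| ≤ 3 * G.Vbar) : G.reflect w ∈ G.states := by
  have h := G.Vbar_pos
  rw [abs_le] at hw
  unfold reflect states
  split_ifs <;> constructor <;> linarith

theorem continuous_jump : Continuous fun p : ℝ × ℝ => G.jump p.1 p.2 := by
  unfold jump
  refine G.continuous_reflect.comp ?_
  unfold collide
  fun_prop

theorem measurable_jump : Measurable fun p : ℝ × ℝ => G.jump p.1 p.2 :=
  G.continuous_jump.measurable

/-- Reflection is 1-Lipschitz, so all the contraction comes from the weight `keep` of the piston's
own velocity. -/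
theorem abs_jump_sub_le (u u' v : ℝ) :
    |G.jump u v - G.jump u' v| ≤ G.keep * |u - u'| := by
  refine (G.abs_reflect_sub_le _ _).trans (le_of_eq ?_)
  rw [collide_eq, collide_eq, ← abs_of_pos G.keep_pos, ← abs_mul, abs_of_pos G.keep_pos]
  congr 1
  ring

/-- A single reflection returns the velocity to the state space. -/
def SingleReflection : Prop :=
  (G.M - G.m) / (G.M + G.m) * G.Vbar + 2 * G.m / (G.M + G.m) * G.vmax ≤ 3 * G.Vbar

variable {G}

theorem SingleReflection.jump_mem (h : G.SingleReflection) {u v : ℝ} (hu : u ∈ G.states)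
    (hv : |v| ≤ G.vmax) : G.jump u v ∈ G.states := by
  refine G.reflect_mem_states ?_
  rw [collide_eq]
  have h' : G.keep * G.Vbar + G.kick * G.vmax ≤ 3 * G.Vbar := h
  have hu' : |u| ≤ G.Vbar := abs_le.2 hu
  calc |G.keep * u + G.kick * v| ≤ |G.keep * u| + |G.kick * v| := abs_add_le _ _
    _ = G.keep * |u| + G.kick * |v| := by
      rw [abs_mul, abs_mul, abs_of_pos G.keep_pos, abs_of_pos G.kick_pos]
    _ ≤ G.keep * G.Vbar + G.kick * G.vmax := by
      gcongr
      · exact G.keep_pos.le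
      · exact G.kick_pos.le
    _ ≤ _ := h'

variable (G)

/-! ### Collision rates and cores -/

theorem measurable_rate : Measurable fun p : ℝ × ℝ => G.rate p.1 p.2 := by
  have h1 := G.fL_measurable
  have h2 := G.fR_measurable
  unfold rate
  refine Measurable.ite (measurableSet_lt measurable_const measurable_snd) ?_ ?_ <;> fun_prop

theorem rate_eq_zero {u v : ℝ} (hv : G.vmax ≤ |v|) : G.rate u v = 0 := by
  unfold rate
  rw [G.fL_cutoff v (Or.inr hv), G.fR_cutoff v (Or.inr hv)]
  simp

theorem rate_le (u v : ℝ) : G.rate u v ≤ ENNReal.ofReal (|u| + G.vmax) *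
    (ENNReal.ofReal G.nL * ENNReal.ofReal (G.fL v) +
      ENNReal.ofReal G.nR * ENNReal.ofReal (G.fR v)) := by
  by_cases hv : G.vmax ≤ |v|
  · rw [G.rate_eq_zero hv]; exact zero_le
  push Not at hv
  have hL := mul_nonneg G.nL_pos.le (G.fL_nonneg v)
  have hR := mul_nonneg G.nR_pos.le (G.fR_nonneg v)
  have hvm : 0 < G.vmax := G.vmin_pos.trans G.vmin_lt_vmax
  rw [← ENNReal.ofReal_mul G.nL_pos.le, ← ENNReal.ofReal_mul G.nR_pos.le,
    ← ENNReal.ofReal_add hL hR, ← ENNReal.ofReal_mul (by positivity)]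
  unfold rate
  have h1 := abs_le.1 hv.le
  have h2 := abs_le.1 (le_refl |u|)
  have h3 := abs_nonneg u
  split_ifs
  · refine ENNReal.ofReal_le_ofReal ?_
    refine mul_le_mul (by linarith) (by linarith) hL (by linarith)
  · refine ENNReal.ofReal_le_ofReal ?_
    refine mul_le_mul (by linarith) (by linarith) hR (by linarith)

theorem lintegral_rate_le (u : ℝ) :
    ∫⁻ v, G.rate u v ≤ ENNReal.ofReal ((|u| + G.vmax) * (G.nL + G.nR)) := by
  have hvm : 0 < G.vmax := G.vmin_pos.trans G.vmin_lt_vmax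
  have h1 := G.fL_measurable
  have h2 := G.fR_measurable
  refine (lintegral_mono (G.rate_le u)).trans (le_of_eq ?_)
  rw [lintegral_const_mul _ (by fun_prop), lintegral_add_left (by fun_prop),
    lintegral_const_mul _ (by fun_prop), lintegral_const_mul _ (by fun_prop), G.fL_prob, G.fR_prob,
    mul_one, mul_one, ← ENNReal.ofReal_add G.nL_pos.le G.nR_pos.le,
    ← ENNReal.ofReal_mul (by positivity)]

theorem ofReal_totalRate (u : ℝ) : ENNReal.ofReal (G.totalRate u) = ∫⁻ v, G.rate u v :=
  ENNReal.ofReal_toReal ((G.lintegral_rate_le u).trans_lt ENNReal.ofReal_lt_top).ne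

theorem totalRate_nonneg (u : ℝ) : 0 ≤ G.totalRate u := ENNReal.toReal_nonneg

/-- An upper bound for the total collision rate on the state space. -/
def maxRate : ℝ := (G.Vbar + G.vmax) * (G.nL + G.nR)

theorem maxRate_pos : 0 < G.maxRate :=
  mul_pos (add_pos G.Vbar_pos (G.vmin_pos.trans G.vmin_lt_vmax)) (add_pos G.nL_pos G.nR_pos)

theorem totalRate_le_maxRate {u : ℝ} (hu : u ∈ G.states) : G.totalRate u ≤ G.maxRate := by
  have hu' : |u| ≤ G.Vbar := abs_le.2 hu
  have h := G.lintegral_rate_le u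
  rw [← G.ofReal_totalRate, ENNReal.ofReal_le_ofReal_iff'] at h
  have hn : 0 < G.nL + G.nR := add_pos G.nL_pos G.nR_pos
  rcases h with h | h
  · refine h.trans ?_
    unfold maxRate
    gcongr
  · exact h.trans G.maxRate_pos.le

theorem measurable_totalRate : Measurable G.totalRate :=
  (Measurable.lintegral_prod_right' G.measurable_rate).ennreal_toReal

/-- `K` is a compact set of atom velocities of positive volume whose collision rates
are at least `c`; its atoms are slower than `vmax`. -/
structure IsCore (K : Set ℝ) (c : ℝ) : Prop where
  isCompact : IsCompact K
  volume_pos : 0 < volume K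
  pos : 0 < c
  le_rate : ∀ u ∈ G.states, ∀ v ∈ K, ENNReal.ofReal c ≤ G.rate u v
  abs_lt : ∀ v ∈ K, |v| < G.vmax

/-- If every superlevel set on the positive axis were null, evenness would make f vanish almost
everywhere, against total mass 1. Inner regularity then supplies a compact subset of a level set of
positive volume. -/
theorem exists_compact_level {f : ℝ → ℝ} (hf : Measurable f)
    (heven : ∀ v, f (-v) = f v) (hprob : ∫⁻ v, ENNReal.ofReal (f v) = 1) :
    ∃ K : Set ℝ, IsCompact K ∧ 0 < volume K ∧ ∃ c : ℝ, 0 < c ∧ ∀ v ∈ K, 0 < v ∧ c < f v := by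
  by_contra! H
  have key : ∀ n : ℕ, volume {v : ℝ | 0 < v ∧ (1 : ℝ) / (n + 1) < f v} = 0 := by
    intro n
    by_contra hne
    have hm : MeasurableSet {v : ℝ | 0 < v ∧ (1 : ℝ) / (n + 1) < f v} :=
      (measurableSet_lt measurable_const measurable_id).inter
        (measurableSet_lt measurable_const hf)
    obtain ⟨K, hK, hKc, hKv⟩ := hm.exists_lt_isCompact (pos_iff_ne_zero.2 hne)
    obtain ⟨v, hv, hv'⟩ := H K hKc hKv (1 / ((n : ℝ) + 1)) (by positivity)
    exact absurd (hv' (hK hv).1) (not_le.2 (hK hv).2)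
  have hpos : volume {v : ℝ | 0 < v ∧ 0 < f v} = 0 := by
    refine measure_mono_null ?_ (measure_iUnion_null key)
    rintro v ⟨hv, hfv⟩
    obtain ⟨n, hn⟩ := exists_nat_one_div_lt hfv
    exact mem_iUnion.2 ⟨n, hv, hn⟩
  have hneg : volume {v : ℝ | v < 0 ∧ 0 < f v} = 0 := by
    have : {v : ℝ | v < 0 ∧ 0 < f v} = -{v : ℝ | 0 < v ∧ 0 < f v} := by
      ext v
      simp [heven]
    rw [this, Measure.measure_neg, hpos]
  have hz : ∀ᵐ v : ℝ, ENNReal.ofReal (f v) = 0 := by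
    have h3 : ∀ᵐ v : ℝ, v ≠ 0 := by simp [ae_iff]
    filter_upwards [measure_eq_zero_iff_ae_notMem.1 hpos,
      measure_eq_zero_iff_ae_notMem.1 hneg, h3] with v h1 h2 h3
    simp only [not_and, not_lt] at h1 h2
    refine ENNReal.ofReal_eq_zero.2 ?_
    rcases lt_or_gt_of_ne h3 with h | h
    · exact h2 h
    · exact h1 h
  rw [lintegral_congr_ae hz] at hprob
  simp at hprob

theorem exists_isCore_left : ∃ K c, G.IsCore K c ∧ ∀ v ∈ K, G.vmin < v := by
  obtain ⟨K, hK, hKv, c, hc, h⟩ :=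
    exists_compact_level G.fL_measurable G.fL_even G.fL_prob
  have hcut : ∀ v ∈ K, G.vmin < |v| ∧ |v| < G.vmax := by
    intro v hv
    by_contra hn
    rw [not_and_or, not_lt, not_lt] at hn
    have := (h v hv).2
    rw [G.fL_cutoff v hn] at this
    linarith
  have hmin : ∀ v ∈ K, G.vmin < v := fun v hv => by
    have := (hcut v hv).1
    rwa [abs_of_pos (h v hv).1] at this
  refine ⟨K, (G.vmin - G.Vbar) * (G.nL * c), ⟨hK, hKv, ?_, ?_, fun v hv => (hcut v hv).2⟩, hmin⟩
  · exact mul_pos (sub_pos.2 G.Vbar_lt_vmin) (mul_pos G.nL_pos hc)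
  · intro u hu v hv
    unfold rate
    rw [if_pos (h v hv).1]
    refine ENNReal.ofReal_le_ofReal ?_
    have h1 := hmin v hv
    have h2 : u ≤ G.Vbar := hu.2
    have h3 := G.Vbar_lt_vmin
    refine mul_le_mul (by linarith) ?_ (mul_pos G.nL_pos hc).le (by linarith)
    exact mul_le_mul_of_nonneg_left (h v hv).2.le G.nL_pos.le

theorem exists_isCore_right : ∃ K c, G.IsCore K c ∧ ∀ v ∈ K, v < -G.vmin := by
  obtain ⟨K, hK, hKv, c, hc, h⟩ :=
    exists_compact_level G.fR_measurable G.fR_even G.fR_prob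
  have hcut : ∀ v ∈ K, G.vmin < |v| ∧ |v| < G.vmax := by
    intro v hv
    by_contra hn
    rw [not_and_or, not_lt, not_lt] at hn
    have := (h v hv).2
    rw [G.fR_cutoff v hn] at this
    linarith
  have hmin : ∀ v ∈ K, G.vmin < v := fun v hv => by
    have := (hcut v hv).1
    rwa [abs_of_pos (h v hv).1] at this
  -- The level set lies on the positive axis; evenness of `fR` mirrors it to atoms arriving from the
  -- right. The constant is the least relative speed times the least density.
  refine ⟨-K, (G.vmin - G.Vbar) * (G.nR * c), ⟨hK.neg, ?_, ?_, ?_, ?_⟩, ?_⟩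
  · rwa [Measure.measure_neg]
  · exact mul_pos (sub_pos.2 G.Vbar_lt_vmin) (mul_pos G.nR_pos hc)
  · intro u hu v hv
    have h0 := h (-v) hv
    unfold rate
    rw [if_neg (by linarith)]
    refine ENNReal.ofReal_le_ofReal ?_
    have h1 := hmin (-v) hv
    have h2 : -G.Vbar ≤ u := hu.1
    have h3 := G.Vbar_lt_vmin
    rw [← G.fR_even v]
    refine mul_le_mul (by linarith) ?_ (mul_pos G.nR_pos hc).le (by linarith)
    exact mul_le_mul_of_nonneg_left h0.2.le G.nR_pos.le
  · intro v hv
    rw [← abs_neg]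
    exact (hcut (-v) hv).2
  · intro v hv
    linarith [hmin (-v) hv]

end PistonModel

/-! ### Expectations sorted by the number of collisions -/

namespace PistonModel

variable (G : PistonModel)

/-- The expectation of `g` after a collision of a piston of velocity `u`, times the total rate. -/
def hit (g : ℝ → ℝ≥0∞) (u : ℝ) : ℝ≥0∞ := ∫⁻ v, G.rate u v * g (G.jump u v)

/-- The expectation of `φ (W t)` on the event that exactly `n` collisions occur during the time
`t`, for a piston started with velocity `u`. -/
def expectN (φ : ℝ → ℝ≥0∞) : ℕ → ℝ → ℝ → ℝ≥0∞
  | 0, t, u => ENNReal.ofReal (Real.exp (-G.totalRate u * t)) * φ u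
  | n + 1, t, u => ∫⁻ s in Ioc 0 t, ENNReal.ofReal (Real.exp (-G.totalRate u * s)) *
      G.hit (expectN φ n (t - s)) u

/-- The expectation of `φ (W t)` for a piston started with velocity `u`. -/
def expect (φ : ℝ → ℝ≥0∞) (t u : ℝ) : ℝ≥0∞ := ∑' n, G.expectN φ n t u

theorem expectN_zero (φ : ℝ → ℝ≥0∞) (t u : ℝ) :
    G.expectN φ 0 t u = ENNReal.ofReal (Real.exp (-G.totalRate u * t)) * φ u := rfl

theorem expectN_succ (φ : ℝ → ℝ≥0∞) (n : ℕ) (t u : ℝ) :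
    G.expectN φ (n + 1) t u = ∫⁻ s in Ioc 0 t, ENNReal.ofReal (Real.exp (-G.totalRate u * s)) *
      G.hit (G.expectN φ n (t - s)) u := rfl

theorem transN_eq (n : ℕ) (t u : ℝ) (A : Set ℝ) :
    G.transN n t u A = G.expectN (A.indicator 1) n t u := by
  induction n generalizing t u with
  | zero => rfl
  | succ n ih => simp only [transN, expectN_succ, hit, ih]

theorem trans_eq (t u : ℝ) (A : Set ℝ) : G.trans t u A = G.expect (A.indicator 1) t u := by
  simp only [trans, expect, transN_eq]

theorem measurable_hit {g : ℝ → ℝ → ℝ≥0∞} (hg : Measurable fun p : ℝ × ℝ => g p.1 p.2) :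
    Measurable fun p : ℝ × ℝ => G.hit (g p.1) p.2 := by
  refine Measurable.lintegral_prod_right'
    (f := fun q : (ℝ × ℝ) × ℝ => G.rate q.1.2 q.2 * g q.1.1 (G.jump q.1.2 q.2)) ?_
  have h1 : Measurable fun q : (ℝ × ℝ) × ℝ => (q.1.2, q.2) := by fun_prop
  refine (G.measurable_rate.comp h1).mul ?_
  exact hg.comp (measurable_fst.fst.prodMk (G.measurable_jump.comp h1))

theorem measurable_expectN_uncurry {φ : ℝ → ℝ≥0∞} (hφ : Measurable φ) (n : ℕ) :
    Measurable fun p : ℝ × ℝ => G.expectN φ n p.1 p.2 := by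
  have hl := G.measurable_totalRate
  induction n with
  | zero => simp only [expectN_zero]; fun_prop
  | succ n ih =>
    simp only [expectN_succ]
    -- The domain of integration depends on the time, so it is moved into an indicator of the
    -- variables (t, u) and s jointly.
    have h2 : Measurable fun q : (ℝ × ℝ) × ℝ =>
        ({q : (ℝ × ℝ) × ℝ | 0 < q.2 ∧ q.2 ≤ q.1.1}.indicator fun q =>
          ENNReal.ofReal (Real.exp (-G.totalRate q.1.2 * q.2)) *
            G.hit (G.expectN φ n (q.1.1 - q.2)) q.1.2) q := by
      refine Measurable.indicator ?_ ?_
      · refine Measurable.mul (by fun_prop) ?_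
        have h1 : Measurable fun q : (ℝ × ℝ) × ℝ => (q.1.1 - q.2, q.1.2) := by fun_prop
        exact (G.measurable_hit ih).comp h1
      · exact (measurableSet_lt measurable_const measurable_snd).inter
          (measurableSet_le measurable_snd measurable_fst.fst)
    convert Measurable.lintegral_prod_right' (ν := volume) h2 using 2 with p
    rw [← lintegral_indicator measurableSet_Ioc]
    rfl

theorem measurable_expectN {φ : ℝ → ℝ≥0∞} (hφ : Measurable φ) (n : ℕ) (t : ℝ) :
    Measurable (G.expectN φ n t) :=
  (G.measurable_expectN_uncurry hφ n).comp measurable_prodMk_left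

theorem measurable_hit_expectN {φ : ℝ → ℝ≥0∞} (hφ : Measurable φ) (n : ℕ) (t u : ℝ) :
    Measurable fun s => G.hit (G.expectN φ n (t - s)) u := by
  have h1 : Measurable fun s : ℝ => (t - s, u) := by fun_prop
  exact (G.measurable_hit (G.measurable_expectN_uncurry hφ n)).comp h1

theorem measurable_expect {φ : ℝ → ℝ≥0∞} (hφ : Measurable φ) (t : ℝ) :
    Measurable (G.expect φ t) :=
  Measurable.tsum fun n => G.measurable_expectN hφ n t

theorem measurable_exp_mul (r : ℝ) : Measurable fun s : ℝ => ENNReal.ofReal (Real.exp (r * s)) := by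
  fun_prop

theorem measurable_exp_mul_hit {φ : ℝ → ℝ≥0∞} (hφ : Measurable φ) (n : ℕ) (t u : ℝ) :
    Measurable fun s => ENNReal.ofReal (Real.exp (-G.totalRate u * s)) *
      G.hit (G.expectN φ n (t - s)) u :=
  (measurable_exp_mul _).mul (G.measurable_hit_expectN hφ n t u)

theorem measurable_rate_mul {g : ℝ → ℝ≥0∞} (hg : Measurable g) (u : ℝ) :
    Measurable fun v => G.rate u v * g (G.jump u v) :=
  (G.measurable_rate.comp measurable_prodMk_left).mul
    (hg.comp (G.measurable_jump.comp measurable_prodMk_left))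

theorem hit_tsum {g : ℕ → ℝ → ℝ≥0∞} (hg : ∀ i, Measurable (g i)) (u : ℝ) :
    G.hit (fun w => ∑' i, g i w) u = ∑' i, G.hit (g i) u := by
  unfold hit
  simp only [← ENNReal.tsum_mul_left]
  exact lintegral_tsum fun i => (G.measurable_rate_mul (hg i) u).aemeasurable

theorem hit_sum {ι : Type*} (I : Finset ι) {g : ι → ℝ → ℝ≥0∞} (hg : ∀ i, Measurable (g i))
    (u : ℝ) : G.hit (fun w => ∑ i ∈ I, g i w) u = ∑ i ∈ I, G.hit (g i) u := by
  unfold hit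
  simp only [Finset.mul_sum]
  exact lintegral_finsetSum I fun i _ => G.measurable_rate_mul (hg i) u

theorem hit_add {g g' : ℝ → ℝ≥0∞} (hg : Measurable g) (u : ℝ) :
    G.hit (fun w => g w + g' w) u = G.hit g u + G.hit g' u := by
  unfold hit
  simp only [mul_add]
  exact lintegral_add_left (G.measurable_rate_mul hg u) _

theorem hit_const (c : ℝ≥0∞) (u : ℝ) :
    G.hit (fun _ => c) u = ENNReal.ofReal (G.totalRate u) * c := by
  have hm : Measurable fun v => G.rate u v := G.measurable_rate.comp measurable_prodMk_left
  unfold hit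
  rw [lintegral_mul_const _ hm, ofReal_totalRate]

theorem hit_const_mul (c : ℝ≥0∞) {g : ℝ → ℝ≥0∞} (hg : Measurable g) (u : ℝ) :
    G.hit (fun w => c * g w) u = c * G.hit g u := by
  unfold hit
  rw [← lintegral_const_mul _ (G.measurable_rate_mul hg u)]
  congr 1 with v
  ring

theorem expectN_tsum {φ : ℕ → ℝ → ℝ≥0∞} (hφ : ∀ i, Measurable (φ i)) (n : ℕ) (t u : ℝ) :
    G.expectN (fun w => ∑' i, φ i w) n t u = ∑' i, G.expectN (φ i) n t u := by
  induction n generalizing t u with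
  | zero => simp only [expectN_zero, ENNReal.tsum_mul_left]
  | succ n ih =>
    simp only [expectN_succ]
    rw [← lintegral_tsum fun i => (G.measurable_exp_mul_hit (hφ i) n t u).aemeasurable]
    congr 1 with s
    have : G.expectN (fun w => ∑' i, φ i w) n (t - s) =
        fun w => ∑' i, G.expectN (φ i) n (t - s) w := funext fun w => ih _ _
    rw [this, hit_tsum _ fun i => G.measurable_expectN (hφ i) n _, ENNReal.tsum_mul_left]

theorem expect_tsum {φ : ℕ → ℝ → ℝ≥0∞} (hφ : ∀ i, Measurable (φ i)) (t u : ℝ) :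
    G.expect (fun w => ∑' i, φ i w) t u = ∑' i, G.expect (φ i) t u := by
  unfold expect
  simp only [G.expectN_tsum hφ]
  exact ENNReal.tsum_comm

theorem expectN_add {φ ψ : ℝ → ℝ≥0∞} (hφ : Measurable φ) (n : ℕ) (t u : ℝ) :
    G.expectN (fun w => φ w + ψ w) n t u = G.expectN φ n t u + G.expectN ψ n t u := by
  induction n generalizing t u with
  | zero => simp only [expectN_zero, mul_add]
  | succ n ih =>
    simp only [expectN_succ]
    rw [← lintegral_add_left (G.measurable_exp_mul_hit hφ n t u)]
    congr 1 with s
    have : G.expectN (fun w => φ w + ψ w) n (t - s) =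
        fun w => G.expectN φ n (t - s) w + G.expectN ψ n (t - s) w := funext fun w => ih _ _
    rw [this, hit_add _ (G.measurable_expectN hφ n _), mul_add]

theorem expect_add {φ ψ : ℝ → ℝ≥0∞} (hφ : Measurable φ) (t u : ℝ) :
    G.expect (fun w => φ w + ψ w) t u = G.expect φ t u + G.expect ψ t u := by
  unfold expect
  simp only [G.expectN_add hφ]
  exact ENNReal.tsum_add

theorem expectN_const_mul (c : ℝ≥0∞) {φ : ℝ → ℝ≥0∞} (hφ : Measurable φ) (n : ℕ) (t u : ℝ) :
    G.expectN (fun w => c * φ w) n t u = c * G.expectN φ n t u := by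
  induction n generalizing t u with
  | zero => simp only [expectN_zero]; ring
  | succ n ih =>
    simp only [expectN_succ]
    rw [← lintegral_const_mul _ (G.measurable_exp_mul_hit hφ n t u)]
    congr 1 with s
    have : G.expectN (fun w => c * φ w) n (t - s) =
        fun w => c * G.expectN φ n (t - s) w := funext fun w => ih _ _
    rw [this, hit_const_mul _ _ (G.measurable_expectN hφ n _)]
    ring

theorem expect_const_mul (c : ℝ≥0∞) {φ : ℝ → ℝ≥0∞} (hφ : Measurable φ) (t u : ℝ) :
    G.expect (fun w => c * φ w) t u = c * G.expect φ t u := by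
  unfold expect
  simp only [G.expectN_const_mul c hφ]
  exact ENNReal.tsum_mul_left

/-- The Chapman-Kolmogorov equation, sorted by the number of collisions. -/
theorem expectN_time_add {φ : ℝ → ℝ≥0∞} (hφ : Measurable φ) (n : ℕ) {s t : ℝ} (hs : 0 ≤ s)
    (ht : 0 ≤ t) (u : ℝ) : G.expectN φ n (s + t) u =
      ∑ p ∈ Finset.HasAntidiagonal.antidiagonal n, G.expectN (G.expectN φ p.2 t) p.1 s u := by
  induction n generalizing s u with
  | zero =>
    simp only [Finset.Nat.antidiagonal_zero, Finset.sum_singleton, expectN_zero]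
    rw [mul_add, Real.exp_add, ENNReal.ofReal_mul (Real.exp_nonneg _), mul_assoc]
  | succ n ih =>
    have hm := fun r => G.measurable_exp_mul_hit hφ n r u
    -- The first collision falls either after s, which gives the term without collisions during s,
    -- or before s, which gives the remaining terms by induction.
    rw [Finset.Nat.sum_antidiagonal_succ, expectN_succ,
      ← Ioc_union_Ioc_eq_Ioc hs (by linarith : s ≤ s + t),
      lintegral_union measurableSet_Ioc (Ioc_disjoint_Ioc_of_le le_rfl), add_comm]
    congr 1
    · rw [← (measurePreserving_add_right volume s).setLIntegral_comp_preimage measurableSet_Ioc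
        (hm _), preimage_add_const_Ioc, sub_self, add_sub_cancel_left, expectN_zero, expectN_succ,
        ← lintegral_const_mul _ (hm _)]
      congr 1 with r
      rw [show s + t - (r + s) = t - r by ring, mul_add, Real.exp_add,
        ENNReal.ofReal_mul (Real.exp_nonneg _)]
      ring
    · have hm' : ∀ p : ℕ × ℕ, Measurable fun r => ENNReal.ofReal (Real.exp (-G.totalRate u * r)) *
          G.hit (G.expectN (G.expectN φ p.2 t) p.1 (s - r)) u := fun p =>
        G.measurable_exp_mul_hit (G.measurable_expectN hφ p.2 t) p.1 s u
      simp only [expectN_succ]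
      rw [← lintegral_finsetSum _ fun p _ => hm' p]
      refine setLIntegral_congr_fun measurableSet_Ioc fun r hr => ?_
      have : G.expectN φ n (s + t - r) = fun w =>
          ∑ p ∈ Finset.HasAntidiagonal.antidiagonal n, G.expectN (G.expectN φ p.2 t) p.1 (s - r) w := by
        funext w
        rw [← ih (sub_nonneg.2 hr.2)]
        congr 1
        ring
      rw [this, hit_sum _ _ fun p : ℕ × ℕ =>
        G.measurable_expectN (G.measurable_expectN hφ p.2 t) p.1 _,
        Finset.mul_sum]

/-- The Chapman-Kolmogorov equation. -/
theorem expect_time_add {φ : ℝ → ℝ≥0∞} (hφ : Measurable φ) {s t : ℝ} (hs : 0 ≤ s)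
    (ht : 0 ≤ t) (u : ℝ) : G.expect φ (s + t) u = G.expect (G.expect φ t) s u := by
  have h1 : G.expect (G.expect φ t) s u = ∑' k, ∑' l, G.expectN (G.expectN φ l t) k s u :=
    tsum_congr fun k => G.expectN_tsum (fun l => G.measurable_expectN hφ l t) k s u
  rw [h1, ← ENNReal.tsum_prod (f := fun k l => G.expectN (G.expectN φ l t) k s u),
    ← Finset.HasAntidiagonal.sigmaAntidiagonalEquivProd.tsum_eq, ENNReal.tsum_sigma']
  refine tsum_congr fun n => ?_
  rw [G.expectN_time_add hφ n hs ht,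
    ← Finset.tsum_subtype (Finset.HasAntidiagonal.antidiagonal n) fun p : ℕ × ℕ =>
      G.expectN (G.expectN φ p.2 t) p.1 s u]
  rfl

/-! ### Confinement to the state space and absence of explosion -/

theorem lintegral_exp_mul (r : ℝ) (hr : 0 ≤ r) {t : ℝ} (ht : 0 ≤ t) :
    ∫⁻ s in Ioc 0 t, ENNReal.ofReal (Real.exp (-r * s)) * ENNReal.ofReal r =
      ENNReal.ofReal (1 - Real.exp (-r * t)) := by
  have hc : Continuous fun s : ℝ => Real.exp (-r * s) * r := by fun_prop
  have h1 : ∫ s in (0 : ℝ)..t, Real.exp (-r * s) * r = 1 - Real.exp (-r * t) := by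
    rw [intervalIntegral.integral_eq_sub_of_hasDerivAt (f := fun s => -Real.exp (-r * s))
      (fun s _ => ?_) (hc.intervalIntegrable _ _)]
    · simp; ring
    · have := (((hasDerivAt_id s).const_mul (-r)).exp).neg
      simpa [Function.comp_def, Pi.neg_def] using this
  rw [← h1, intervalIntegral.integral_of_le ht, ofReal_integral_eq_lintegral_ofReal]
  · simp only [ENNReal.ofReal_mul (Real.exp_nonneg _)]
  · exact (hc.integrableOn_Icc).mono_set Ioc_subset_Icc_self
  · exact Filter.Eventually.of_forall fun s => by positivity

variable {G}

/-- A comparison on the states suffices: atoms with nonzero rate are slower than `vmax`, and these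
keep the piston among the states. -/
theorem SingleReflection.hit_mono (h : G.SingleReflection) {g g' : ℝ → ℝ≥0∞}
    (hg : ∀ w ∈ G.states, g w ≤ g' w) {u : ℝ} (hu : u ∈ G.states) : G.hit g u ≤ G.hit g' u := by
  refine lintegral_mono fun v => ?_
  by_cases hv : G.vmax ≤ |v|
  · simp [G.rate_eq_zero hv]
  · exact mul_le_mul_right (hg _ (h.jump_mem hu (not_le.1 hv).le)) _

theorem SingleReflection.expectN_mono (h : G.SingleReflection) {φ ψ : ℝ → ℝ≥0∞}
    (hφ : ∀ w ∈ G.states, φ w ≤ ψ w) (n : ℕ) (t : ℝ) {u : ℝ} (hu : u ∈ G.states) :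
    G.expectN φ n t u ≤ G.expectN ψ n t u := by
  induction n generalizing t u with
  | zero => exact mul_le_mul_right (hφ u hu) _
  | succ n ih =>
    exact lintegral_mono fun s => mul_le_mul_right (h.hit_mono (fun w hw => ih _ hw) hu) _

theorem SingleReflection.expect_mono (h : G.SingleReflection) {φ ψ : ℝ → ℝ≥0∞}
    (hφ : ∀ w ∈ G.states, φ w ≤ ψ w) (t : ℝ) {u : ℝ} (hu : u ∈ G.states) :
    G.expect φ t u ≤ G.expect ψ t u :=
  ENNReal.tsum_le_tsum fun n => h.expectN_mono hφ n t hu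

-- Conditioning on the first collision turns partial sums over the number of collisions into a
-- recursion, on which both bounds for the total mass rest.
variable (G) in
theorem sum_expectN_succ {φ : ℝ → ℝ≥0∞} (hφ : Measurable φ) (N : ℕ) (t u : ℝ) :
    ∑ n ∈ Finset.range (N + 1), G.expectN φ n t u =
      (∫⁻ s in Ioc 0 t, ENNReal.ofReal (Real.exp (-G.totalRate u * s)) *
        G.hit (fun w => ∑ n ∈ Finset.range N, G.expectN φ n (t - s) w) u) +
      ENNReal.ofReal (Real.exp (-G.totalRate u * t)) * φ u := by
  rw [Finset.sum_range_succ']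
  congr 1
  simp only [expectN_succ]
  rw [← lintegral_finsetSum _ fun n _ => G.measurable_exp_mul_hit hφ n t u]
  congr 1 with s
  rw [hit_sum _ _ fun n => G.measurable_expectN hφ n _, Finset.mul_sum]

variable (G) in
theorem ofReal_one_sub_exp_add (u t : ℝ) (ht : 0 ≤ t) :
    ENNReal.ofReal (1 - Real.exp (-G.totalRate u * t)) +
      ENNReal.ofReal (Real.exp (-G.totalRate u * t)) = 1 := by
  rw [← ENNReal.ofReal_add _ (Real.exp_nonneg _), sub_add_cancel, ENNReal.ofReal_one]
  rw [sub_nonneg, Real.exp_le_one_iff]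
  have := mul_nonneg (G.totalRate_nonneg u) ht
  linarith

theorem SingleReflection.sum_expectN_one_le (h : G.SingleReflection) (N : ℕ) {t : ℝ} (ht : 0 ≤ t)
    {u : ℝ} (hu : u ∈ G.states) :
    ∑ n ∈ Finset.range N, G.expectN (fun _ => 1) n t u ≤ 1 := by
  induction N generalizing t u with
  | zero => simp
  | succ N ih =>
    rw [G.sum_expectN_succ measurable_const, mul_one]
    refine le_trans ?_ (G.ofReal_one_sub_exp_add u t ht).le
    gcongr
    rw [← lintegral_exp_mul _ (G.totalRate_nonneg u) ht]
    refine setLIntegral_mono' measurableSet_Ioc fun s hs => ?_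
    gcongr
    refine (h.hit_mono (fun w hw => ih (sub_nonneg.2 hs.2) hw) hu).trans ?_
    rw [hit_const, mul_one]

/-- The missing mass belongs to at least N collisions before T, each of which occurs in time with
conditional probability at most 1 - exp(-`maxRate` T). The fixed horizon T keeps this factor the
same throughout the induction, while t decreases. -/
theorem SingleReflection.one_le_sum_expectN (h : G.SingleReflection) (N : ℕ) {t T : ℝ}
    (ht : 0 ≤ t) (hT : t ≤ T) {u : ℝ} (hu : u ∈ G.states) :
    1 ≤ ∑ n ∈ Finset.range N, G.expectN (fun _ => 1) n t u +
      ENNReal.ofReal (1 - Real.exp (-G.maxRate * T)) ^ N := by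
  induction N generalizing t u with
  | zero => simp
  | succ N ih =>
    set q := ENNReal.ofReal (1 - Real.exp (-G.maxRate * T)) with hq
    have hone : Measurable fun _ : ℝ => (1 : ℝ≥0∞) := measurable_const
    have hle : ENNReal.ofReal (1 - Real.exp (-G.totalRate u * t)) ≤ q := by
      refine ENNReal.ofReal_le_ofReal (sub_le_sub_left (Real.exp_le_exp.2 ?_) _)
      have := mul_le_mul (G.totalRate_le_maxRate hu) hT ht G.maxRate_pos.le
      linarith
    rw [G.sum_expectN_succ hone, mul_one, pow_succ']
    have key : ENNReal.ofReal (1 - Real.exp (-G.totalRate u * t)) ≤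
        (∫⁻ s in Ioc 0 t, ENNReal.ofReal (Real.exp (-G.totalRate u * s)) *
          G.hit (fun w => ∑ n ∈ Finset.range N, G.expectN (fun _ => 1) n (t - s) w) u) +
        ENNReal.ofReal (1 - Real.exp (-G.totalRate u * t)) * q ^ N := by
      conv_lhs => rw [← lintegral_exp_mul _ (G.totalRate_nonneg u) ht]
      conv_rhs => rw [← lintegral_exp_mul _ (G.totalRate_nonneg u) ht]
      rw [← lintegral_mul_const _ ((measurable_exp_mul _).mul_const _),
        ← lintegral_add_right _ (((measurable_exp_mul _).mul_const _).mul_const _)]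
      refine setLIntegral_mono' measurableSet_Ioc fun s hs => ?_
      rw [mul_assoc, ← mul_add]
      gcongr
      have h1 : G.hit (fun _ => 1) u ≤ G.hit (fun w =>
          ∑ n ∈ Finset.range N, G.expectN (fun _ => 1) n (t - s) w + q ^ N) u :=
        h.hit_mono (fun w hw => ih (sub_nonneg.2 hs.2) (by linarith [hs.1]) hw) hu
      rwa [hit_const, mul_one, hit_add _ (Finset.measurable_sum _ fun n _ =>
        G.measurable_expectN hone n _), hit_const] at h1
    calc (1 : ℝ≥0∞) = _ := (G.ofReal_one_sub_exp_add u t ht).symm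
      _ ≤ _ := add_le_add_left key _
      _ ≤ _ := by
        rw [add_right_comm]
        gcongr

/-- The process does not explode. -/
theorem SingleReflection.expect_one (h : G.SingleReflection) {t : ℝ} (ht : 0 ≤ t) {u : ℝ}
    (hu : u ∈ G.states) : G.expect (fun _ => 1) t u = 1 := by
  have hlim := ENNReal.tendsto_nat_tsum fun n => G.expectN (fun _ => 1) n t u
  refine le_antisymm (le_of_tendsto' hlim fun N => h.sum_expectN_one_le N ht hu) ?_
  have hq : ENNReal.ofReal (1 - Real.exp (-G.maxRate * t)) < 1 := by
    rw [ENNReal.ofReal_lt_one]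
    linarith [Real.exp_pos (-G.maxRate * t)]
  have := hlim.add (ENNReal.tendsto_pow_atTop_nhds_zero_of_lt_one hq)
  rw [add_zero] at this
  exact ge_of_tendsto' this fun N => h.one_le_sum_expectN N ht le_rfl hu

theorem SingleReflection.expect_const (h : G.SingleReflection) (c : ℝ≥0∞) {t : ℝ} (ht : 0 ≤ t)
    {u : ℝ} (hu : u ∈ G.states) : G.expect (fun _ => c) t u = c := by
  have := G.expect_const_mul c (φ := fun _ => 1) measurable_const t u
  rwa [h.expect_one ht hu, mul_one] at this

/-- The weight of the distribution after unit time that comes from a single collision with an atom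
whose velocity lies in a core with rates at least `c`. -/
def hitWeight (G : PistonModel) (c : ℝ) : ℝ≥0∞ :=
  ENNReal.ofReal (Real.exp (-G.maxRate)) * (ENNReal.ofReal c * ENNReal.ofReal (Real.exp (-G.maxRate)))

theorem hitWeight_pos {c : ℝ} (hc : 0 < c) : 0 < G.hitWeight c := by
  unfold hitWeight
  have := Real.exp_pos (-G.maxRate)
  refine ENNReal.mul_pos ?_ (ENNReal.mul_pos ?_ ?_).ne' <;> simpa

theorem SingleReflection.hitWeight_mul_le_expect (h : G.SingleReflection) {K : Set ℝ} {c : ℝ}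
    (hK : G.IsCore K c) {φ : ℝ → ℝ≥0∞} (hφ : Measurable φ) {u : ℝ} (hu : u ∈ G.states) :
    G.hitWeight c * ∫⁻ v in K, φ (G.jump u v) ≤ G.expect φ 1 u := by
  have hexp : ∀ w ∈ G.states, ∀ s : ℝ, 0 ≤ s → s ≤ 1 →
      ENNReal.ofReal (Real.exp (-G.maxRate)) ≤ ENNReal.ofReal (Real.exp (-G.totalRate w * s)) := by
    intro w hw s h0 h1
    refine ENNReal.ofReal_le_ofReal (Real.exp_le_exp.2 ?_)
    have := mul_le_mul (G.totalRate_le_maxRate hw) h1 h0 G.maxRate_pos.le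
    linarith
  have hm : Measurable fun v => φ (G.jump u v) :=
    hφ.comp (G.measurable_jump.comp measurable_prodMk_left)
  -- Only trajectories with exactly one collision are kept: survival until s, a hit by an atom of K,
  -- survival from s to 1. The integral over s has total length 1.
  refine le_trans ?_ (ENNReal.le_tsum 1)
  rw [expectN_succ]
  calc G.hitWeight c * ∫⁻ v in K, φ (G.jump u v)
      = ∫⁻ s in Ioc (0 : ℝ) 1, G.hitWeight c * ∫⁻ v in K, φ (G.jump u v) := by simp
    _ ≤ _ := by
      refine setLIntegral_mono' measurableSet_Ioc fun s hs => ?_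
      rw [hitWeight, mul_assoc]
      refine mul_le_mul' (hexp u hu s hs.1.le hs.2) ?_
      rw [← lintegral_const_mul _ hm, ← lintegral_indicator hK.isCompact.measurableSet]
      refine lintegral_mono fun v => ?_
      by_cases hv : v ∈ K
      · rw [indicator_of_mem hv, mul_assoc, expectN_zero]
        refine mul_le_mul' (hK.le_rate u hu v hv) (mul_le_mul_left ?_ _)
        exact hexp _ (h.jump_mem hu (hK.abs_lt v hv).le) _ (by linarith [hs.2]) (by linarith [hs.1])
      · rw [indicator_of_notMem hv]
        exact zero_le

end PistonModel

open Filter Topology in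
/-- The measure of a translate of a compact set depends lower semicontinuously on the translate,
for a finite measure with a density. -/
theorem lowerSemicontinuous_measure_translate (μ : Measure ℝ) [IsFiniteMeasure μ]
    (hμ : μ ≪ volume) {K : Set ℝ} (hK : IsCompact K) :
    LowerSemicontinuous fun x => μ {z | z - x ∈ K} := by
  intro x₀ y hy
  -- For compact K the volume lost under a small translation tends to 0; absolute continuity carries
  -- this over to μ.
  have hvol : Tendsto (fun x => volume ({z | z - x₀ ∈ K} \ {z | z - x ∈ K})) (𝓝 x₀) (𝓝 0) := by
    have h1 := tendsto_measure_vadd_sdiff_isCompact_isClosed (μ := (volume : Measure ℝ)) hK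
      hK.isClosed
    have h2 : Tendsto (fun x : ℝ => x₀ - x) (𝓝 x₀) (𝓝 0) := by
      have : Continuous fun x : ℝ => x₀ - x := by fun_prop
      simpa using this.tendsto x₀
    refine (h1.comp h2).congr fun x => ?_
    rw [← measure_preimage_add_right volume x ({z | z - x₀ ∈ K} \ {z | z - x ∈ K})]
    refine congrArg (volume : Measure ℝ) (Set.ext fun z => ?_)
    simp only [Set.mem_sdiff, mem_preimage, mem_ofPred_eq, mem_vadd_set_iff_neg_vadd_mem, vadd_eq_add,
      add_sub_cancel_right]
    rw [show -(x₀ - x) + z = z + x - x₀ by ring]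
  have hsmall : Tendsto (fun x => μ ({z | z - x₀ ∈ K} \ {z | z - x ∈ K})) (𝓝 x₀) (𝓝 0) := by
    have := tendsto_setLIntegral_zero (f := μ.rnDeriv volume)
      (Measure.lintegral_rnDeriv_lt_top μ volume).ne hvol
    refine this.congr fun x => ?_
    exact Measure.setLIntegral_rnDeriv hμ _
  have hsub : Tendsto (fun x => μ {z | z - x₀ ∈ K} - μ ({z | z - x₀ ∈ K} \ {z | z - x ∈ K}))
      (𝓝 x₀) (𝓝 (μ {z | z - x₀ ∈ K})) := by
    have := ENNReal.Tendsto.sub (tendsto_const_nhds (x := μ {z | z - x₀ ∈ K})) hsmall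
      (Or.inl (measure_ne_top μ _))
    rwa [tsub_zero] at this
  filter_upwards [hsub.eventually_const_lt hy] with x hx
  refine hx.trans_le (tsub_le_iff_right.2 ?_)
  refine (measure_mono ?_).trans (measure_union_le _ _)
  intro z hz
  by_cases h : z - x ∈ K
  · exact Or.inl h
  · exact Or.inr ⟨hz, h⟩

/-! ### Overlap of laws and exponential mixing -/

namespace PistonModel

/-- From any two states at distance at most `ρ`, the distributions after the time `n` have a common
part of mass at least `ε`. -/
def Overlap (G : PistonModel) (n : ℕ) (ρ : ℝ) (ε : ℝ≥0∞) : Prop :=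
  ∀ u ∈ G.states, ∀ u' ∈ G.states, |u - u'| ≤ ρ → ∀ φ ψ : ℝ → ℝ≥0∞, Measurable φ → Measurable ψ →
    (∀ w ∈ G.states, 1 ≤ φ w + ψ w) → ε ≤ G.expect φ n u + G.expect ψ n u'

variable {G : PistonModel}

/-- A small change of the piston's velocity can be compensated by a small change of the atom's, and
K meets its small translates in at least half of its volume. -/
theorem SingleReflection.exists_overlap_one (h : G.SingleReflection) {K : Set ℝ} {c : ℝ}
    (hK : G.IsCore K c) : ∃ ρ > 0, ∃ ε > 0, G.Overlap 1 ρ ε := by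
  have hKm := hK.isCompact.measurableSet
  have hfin : IsFiniteMeasure (volume.restrict K) :=
    ⟨by simpa using hK.isCompact.measure_lt_top⟩
  have hlsc := lowerSemicontinuous_measure_translate (volume.restrict K)
    Measure.restrict_le_self.absolutelyContinuous hK.isCompact
  have hhalf : volume K / 2 < volume.restrict K {z | z - 0 ∈ K} := by
    simp only [sub_zero, ofPred_mem_eq, Measure.restrict_apply_self]
    exact ENNReal.half_lt_self hK.volume_pos.ne' hK.isCompact.measure_lt_top.ne
  obtain ⟨r, hr, hball⟩ := Metric.eventually_nhds_iff.1 (hlsc 0 _ hhalf)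
  have ha := G.keep_pos
  have hb := G.kick_pos
  -- With this ρ the compensating shift x below has absolute value at most r/2.
  refine ⟨G.kick * r / (2 * G.keep), by positivity, G.hitWeight c * (volume K / 2),
    ENNReal.mul_pos (hitWeight_pos hK.pos).ne' (by simpa using hK.volume_pos.ne'), ?_⟩
  intro u hu u' hu' huu φ ψ hφ hψ hφψ
  set x := G.keep * (u' - u) / G.kick with hx
  have hxr : dist x 0 < r := by
    rw [Real.dist_eq, sub_zero, hx, abs_div, abs_mul, abs_of_pos ha, abs_of_pos hb, abs_sub_comm,
      div_lt_iff₀ hb]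
    rw [le_div_iff₀ (by positivity)] at huu
    nlinarith [mul_pos hb hr]
  have hjump : ∀ v, G.jump u' v = G.jump u (v + x) := by
    intro v
    unfold jump
    congr 1
    rw [collide_eq, collide_eq, hx]
    field_simp
    ring
  have hm : ∀ χ : ℝ → ℝ≥0∞, Measurable χ → Measurable fun v => χ (G.jump u v) := fun χ hχ =>
    hχ.comp (G.measurable_jump.comp measurable_prodMk_left)
  have hTm : MeasurableSet {z : ℝ | z - x ∈ K} := hKm.preimage (measurable_id.sub_const x)
  have hshift : ∫⁻ v in K, ψ (G.jump u' v) = ∫⁻ v in {z | z - x ∈ K}, ψ (G.jump u v) := by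
    rw [← (measurePreserving_add_right volume x).setLIntegral_comp_preimage hTm (hm ψ hψ)]
    simp only [hjump]
    congr 2
    ext z
    simp
  have h1 := h.hitWeight_mul_le_expect hK hφ hu
  have h2 := h.hitWeight_mul_le_expect hK hψ hu'
  rw [hshift] at h2
  rw [Nat.cast_one]
  refine le_trans ?_ (add_le_add h1 h2)
  rw [← mul_add]
  refine mul_le_mul_right ?_ _
  calc volume K / 2 ≤ volume ({z | z - x ∈ K} ∩ K) := by
        rw [← Measure.restrict_apply hTm]
        exact (hball hxr).le
    _ = ∫⁻ v in {z | z - x ∈ K} ∩ K, 1 := by simp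
    _ ≤ ∫⁻ v in {z | z - x ∈ K} ∩ K, (φ (G.jump u v) + ψ (G.jump u v)) := by
        refine setLIntegral_mono' (hTm.inter hKm) fun v hv => ?_
        exact hφψ _ (h.jump_mem hu (hK.abs_lt v hv.2).le)
    _ = (∫⁻ v in {z | z - x ∈ K} ∩ K, φ (G.jump u v)) +
          ∫⁻ v in {z | z - x ∈ K} ∩ K, ψ (G.jump u v) := lintegral_add_left (hm φ hφ) _
    _ ≤ _ := add_le_add (lintegral_mono_set inter_subset_right)
        (lintegral_mono_set inter_subset_left)

/-- Let both pistons be hit by the same core atom: their distance shrinks by the factor `keep`, so a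
distance of ρ/`keep` drops to at most ρ. -/
theorem SingleReflection.overlap_succ (h : G.SingleReflection) {K : Set ℝ} {c : ℝ}
    (hK : G.IsCore K c) {n : ℕ} {ρ : ℝ} {ε : ℝ≥0∞} (ho : G.Overlap n ρ ε) :
    G.Overlap (n + 1) (ρ / G.keep) (G.hitWeight c * (ε * volume K)) := by
  intro u hu u' hu' huu φ ψ hφ hψ hφψ
  have hadd : ∀ χ : ℝ → ℝ≥0∞, Measurable χ → ∀ w,
      G.expect χ ((n + 1 : ℕ) : ℝ) w = G.expect (G.expect χ n) 1 w := by
    intro χ hχ w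
    rw [Nat.cast_add, Nat.cast_one, add_comm]
    exact G.expect_time_add hχ zero_le_one (Nat.cast_nonneg n) w
  rw [hadd φ hφ, hadd ψ hψ]
  refine le_trans ?_ (add_le_add
    (h.hitWeight_mul_le_expect hK (G.measurable_expect hφ n) hu)
    (h.hitWeight_mul_le_expect hK (G.measurable_expect hψ n) hu'))
  rw [← mul_add]
  refine mul_le_mul_right ?_ _
  have hm : Measurable fun v => G.expect φ n (G.jump u v) :=
    (G.measurable_expect hφ n).comp (G.measurable_jump.comp measurable_prodMk_left)
  rw [← lintegral_add_left hm, ← setLIntegral_const]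
  refine setLIntegral_mono' hK.isCompact.measurableSet fun v hv => ?_
  refine ho _ (h.jump_mem hu (hK.abs_lt v hv).le) _ (h.jump_mem hu' (hK.abs_lt v hv).le) ?_
    φ ψ hφ hψ hφψ
  rw [le_div_iff₀ G.keep_pos, mul_comm] at huu
  exact (G.abs_jump_sub_le u u' v).trans huu

theorem SingleReflection.exists_overlap (h : G.SingleReflection) :
    ∃ n : ℕ, 0 < n ∧ ∃ ε > 0, G.Overlap n (2 * G.Vbar) ε := by
  obtain ⟨K, c, hK, -⟩ := G.exists_isCore_left
  obtain ⟨ρ, hρ, ε, hε, ho⟩ := h.exists_overlap_one hK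
  have key : ∀ k : ℕ, ∃ ε > 0, G.Overlap (k + 1) (ρ / G.keep ^ k) ε := by
    intro k
    induction k with
    | zero => exact ⟨ε, hε, by simpa using ho⟩
    | succ k ih =>
      obtain ⟨ε', hε', ho'⟩ := ih
      refine ⟨_, ?_, by simpa only [pow_succ, div_div] using h.overlap_succ hK ho'⟩
      exact ENNReal.mul_pos (hitWeight_pos hK.pos).ne'
        (ENNReal.mul_pos hε'.ne' hK.volume_pos.ne').ne'
  have hV := G.Vbar_pos
  obtain ⟨k, hk⟩ := exists_pow_lt_of_lt_one (show 0 < ρ / (2 * G.Vbar) by positivity) G.keep_lt_one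
  obtain ⟨ε', hε', ho'⟩ := key k
  refine ⟨k + 1, k.succ_pos, ε', hε', fun u hu u' hu' huu => ho' u hu u' hu' (huu.trans ?_)⟩
  rw [le_div_iff₀ (pow_pos G.keep_pos k)]
  rw [lt_div_iff₀ (by positivity)] at hk
  linarith

/-- An overlap of all distributions after the time `n` contracts oscillations. -/
theorem SingleReflection.expect_le_expect_add (h : G.SingleReflection) {n : ℕ} {ε : ℝ≥0∞}
    (ho : G.Overlap n (2 * G.Vbar) ε) {φ : ℝ → ℝ≥0∞} (hφ : Measurable φ)
    (hφ1 : ∀ w ∈ G.states, φ w ≤ 1) {d : ℝ≥0∞} (hd : d ≤ 1)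
    (hosc : ∀ w ∈ G.states, ∀ w' ∈ G.states, φ w ≤ φ w' + d) {u u' : ℝ} (hu : u ∈ G.states)
    (hu' : u' ∈ G.states) : G.expect φ n u ≤ G.expect φ n u' + (1 - ε) * d := by
  have hn : (0 : ℝ) ≤ n := Nat.cast_nonneg n
  have huu : |u - u'| ≤ 2 * G.Vbar := by
    rw [abs_le]
    constructor <;> linarith [hu.1, hu.2, hu'.1, hu'.2]
  have hdt : d ≠ ⊤ := ne_top_of_le_ne_top ENNReal.one_ne_top hd
  have hε1 : ε ≤ 1 := by
    have := ho u hu u' hu' huu (fun _ => 1) (fun _ => 0) measurable_const measurable_const (by simp)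
    rwa [h.expect_const _ hn hu, h.expect_const _ hn hu', add_zero] at this
  -- The overlap property, rescaled by homogeneity from sums at least 1 to sums at least d.
  have scaled : ∀ φ₁ φ₂ : ℝ → ℝ≥0∞, Measurable φ₁ → Measurable φ₂ →
      (∀ w ∈ G.states, d ≤ φ₁ w + φ₂ w) → ε * d ≤ G.expect φ₁ n u + G.expect φ₂ n u' := by
    intro φ₁ φ₂ h₁ h₂ h12
    rcases eq_or_ne d 0 with rfl | hd0
    · simp
    have := ho u hu u' hu' huu (fun w => d⁻¹ * φ₁ w) (fun w => d⁻¹ * φ₂ w) (h₁.const_mul _)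
      (h₂.const_mul _) fun w hw => by
        rw [← mul_add, ← ENNReal.inv_mul_cancel hd0 hdt]
        exact mul_le_mul_right (h12 w hw) _
    rw [G.expect_const_mul _ h₁, G.expect_const_mul _ h₂, ← mul_add, mul_comm, ← div_eq_mul_inv,
      ENNReal.le_div_iff_mul_le (Or.inl hd0) (Or.inl hdt)] at this
    exact this
  set e := ⨅ w : G.states, φ w with he
  have hφe : ∀ w ∈ G.states, e ≤ φ w := fun w hw => iInf_le (fun w : G.states => φ w) ⟨w, hw⟩
  have hφd : ∀ w ∈ G.states, φ w ≤ e + d := by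
    intro w hw
    rw [he, ENNReal.iInf_add]
    exact le_iInf fun w' => hosc w hw w' w'.2
  have het : e ≠ ⊤ := ne_top_of_le_ne_top ENNReal.one_ne_top ((hφe u hu).trans (hφ1 u hu))
  have hm : Measurable fun w => e + d - φ w := measurable_const.sub hφ
  -- On the states φ lies between its infimum e and e + d. Its distances to the two bounds are
  -- nonnegative and add up to d, so the overlap gains ε d over the trivial estimate.
  have hs := scaled (fun w => e + d - φ w) (fun w => φ w - e) hm
    (hφ.sub_const e) fun w hw => by
      have h1 := tsub_add_cancel_of_le (hφd w hw)
      have h3 : e + d ≤ e + (e + d - φ w + (φ w - e)) := by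
        rw [add_left_comm, add_tsub_cancel_of_le (hφe w hw), h1]
      exact (ENNReal.add_le_add_iff_left het).1 h3
  have hup : G.expect (fun w => e + d - φ w) n u + G.expect φ n u = e + d := by
    rw [← G.expect_add hm]
    refine Eq.trans ?_ (h.expect_const (e + d) hn hu)
    exact le_antisymm (h.expect_mono (fun w hw => (tsub_add_cancel_of_le (hφd w hw)).le) _ hu)
      (h.expect_mono (fun w hw => (tsub_add_cancel_of_le (hφd w hw)).ge) _ hu)
  have hlow : G.expect (fun w => φ w - e) n u' + e = G.expect φ n u' := by
    have he' : G.expect (fun _ => e) n u' = e := h.expect_const e hn hu'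
    nth_rewrite 2 [← he']
    rw [← G.expect_add (hφ.sub_const e)]
    exact le_antisymm (h.expect_mono (fun w hw => (tsub_add_cancel_of_le (hφe w hw)).le) _ hu')
      (h.expect_mono (fun w hw => (tsub_add_cancel_of_le (hφe w hw)).ge) _ hu')
  have hεd : ε * d ≠ ⊤ := ENNReal.mul_ne_top (ne_top_of_le_ne_top ENNReal.one_ne_top hε1) hdt
  refine (ENNReal.add_le_add_iff_left hεd).1 ?_
  calc ε * d + G.expect φ n u
      ≤ G.expect (fun w => e + d - φ w) n u + G.expect (fun w => φ w - e) n u' +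
          G.expect φ n u := add_le_add_left hs _
    _ = (e + d) + G.expect (fun w => φ w - e) n u' := by rw [add_right_comm, hup]
    _ = G.expect φ n u' + d := by rw [← hlow]; ring
    _ = G.expect φ n u' + (ε + (1 - ε)) * d := by rw [add_tsub_cancel_of_le hε1, one_mul]
    _ = _ := by ring

/-- The oscillation of the expectations of a test function decays exponentially. -/
def Mixing (G : PistonModel) (C γ : ℝ) : Prop :=
  ∀ φ : ℝ → ℝ≥0∞, Measurable φ → (∀ w ∈ G.states, φ w ≤ 1) → ∀ t : ℝ, 0 ≤ t →
    ∀ u ∈ G.states, ∀ u' ∈ G.states,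
      G.expect φ t u ≤ G.expect φ t u' + ENNReal.ofReal (C * Real.exp (-γ * t))

theorem SingleReflection.expect_le_one (h : G.SingleReflection) {φ : ℝ → ℝ≥0∞}
    (hφ1 : ∀ w ∈ G.states, φ w ≤ 1) {t : ℝ} (ht : 0 ≤ t) {u : ℝ} (hu : u ∈ G.states) :
    G.expect φ t u ≤ 1 :=
  (h.expect_mono hφ1 t hu).trans (h.expect_one ht hu).le

theorem SingleReflection.expect_mul_le (h : G.SingleReflection) {n : ℕ} {ε : ℝ≥0∞}
    (ho : G.Overlap n (2 * G.Vbar) ε) {φ : ℝ → ℝ≥0∞} (hφ : Measurable φ)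
    (hφ1 : ∀ w ∈ G.states, φ w ≤ 1) (k : ℕ) {u u' : ℝ} (hu : u ∈ G.states)
    (hu' : u' ∈ G.states) :
    G.expect φ (k * n) u ≤ G.expect φ (k * n) u' + (1 - ε) ^ k := by
  have hn : (0 : ℝ) ≤ n := Nat.cast_nonneg n
  induction k generalizing u u' with
  | zero =>
    have : (0 : ℝ) ≤ (0 : ℕ) * n := by simp
    rw [pow_zero]
    exact (h.expect_le_one hφ1 this hu).trans le_add_self
  | succ k ih =>
    have hkn : (0 : ℝ) ≤ k * n := by positivity
    have hadd : ∀ w, G.expect φ ((k + 1 : ℕ) * n) w = G.expect (G.expect φ (k * n)) n w := by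
      intro w
      rw [← G.expect_time_add hφ hn hkn]
      congr 1
      push_cast
      ring
    rw [hadd, hadd, pow_succ']
    exact h.expect_le_expect_add ho (G.measurable_expect hφ _)
      (fun w hw => h.expect_le_one hφ1 hkn hw) (pow_le_one₀ zero_le tsub_le_self)
      (fun w hw w' hw' => ih hw hw') hu hu'

theorem SingleReflection.exists_mixing (h : G.SingleReflection) :
    ∃ C γ : ℝ, 0 < C ∧ 0 < γ ∧ G.Mixing C γ := by
  obtain ⟨n, hn, ε, hε, ho⟩ := h.exists_overlap
  have hn' : (0 : ℝ) < n := Nat.cast_pos.2 hn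
  -- The maximum with 1/2 keeps q positive, so that its logarithm gives a finite rate even if ε = 1.
  set q := max (1 - ε).toReal (1 / 2) with hq
  have hlt : 1 - ε < 1 := ENNReal.sub_lt_self ENNReal.one_ne_top one_ne_zero hε.ne'
  have hq0 : 0 < q := lt_max_of_lt_right (by norm_num)
  have hq1 : q < 1 := by
    refine max_lt ?_ (by norm_num)
    rw [← ENNReal.toReal_one]
    exact (ENNReal.toReal_lt_toReal hlt.ne_top ENNReal.one_ne_top).2 hlt
  have hle : 1 - ε ≤ ENNReal.ofReal q := by
    rw [ENNReal.le_ofReal_iff_toReal_le hlt.ne_top hq0.le]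
    exact le_max_left _ _
  -- The factor q⁻¹ pays for rounding t/n down to an integer.
  refine ⟨q⁻¹, -Real.log q / n, by positivity, div_pos (neg_pos.2 (Real.log_neg hq0 hq1)) hn', ?_⟩
  intro φ hφ hφ1 t ht u hu u' hu'
  set k := ⌊t / n⌋₊
  have hk : (k : ℝ) * n ≤ t := by
    rw [← le_div_iff₀ hn']
    exact Nat.floor_le (by positivity)
  have hk' : t / n - 1 ≤ k := by linarith [Nat.lt_floor_add_one (t / n)]
  have hs : 0 ≤ t - k * n := sub_nonneg.2 hk
  have hadd : ∀ w, G.expect φ t w = G.expect (G.expect φ (t - k * n)) (k * n) w := by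
    intro w
    rw [← G.expect_time_add hφ (by positivity) hs]
    congr 1
    ring
  rw [hadd, hadd]
  refine (h.expect_mul_le ho (G.measurable_expect hφ _)
    (fun w hw => h.expect_le_one hφ1 hs hw) k hu hu').trans (add_le_add_right ?_ _)
  refine (pow_le_pow_left₀ zero_le hle k).trans ?_
  rw [← ENNReal.ofReal_pow hq0.le]
  refine ENNReal.ofReal_le_ofReal ?_
  calc q ^ k = q ^ (k : ℝ) := (Real.rpow_natCast q k).symm
    _ ≤ q ^ (t / n - 1) := Real.rpow_le_rpow_of_exponent_ge hq0 hq1.le hk'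
    _ = q⁻¹ * Real.exp (-(-Real.log q / n) * t) := by
      rw [Real.rpow_sub_one hq0.ne', Real.rpow_def_of_pos hq0, div_eq_inv_mul]
      congr 2
      ring

end PistonModel

/-! ### The limit law and its stationarity -/

/-- By the layer-cake formula both integrals are averages of the measures of superlevel sets over
levels in (0,1), an interval of length 1, so the error d is not enlarged. -/
theorem lintegral_le_lintegral_add {α : Type*} [MeasurableSpace α] {μ ν : Measure α} {d : ℝ≥0∞}
    (h : ∀ A, MeasurableSet A → μ A ≤ ν A + d) {g : α → ℝ≥0∞} (hg : Measurable g)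
    (hg1 : ∀ x, g x ≤ 1) : ∫⁻ x, g x ∂μ ≤ ∫⁻ x, g x ∂ν + d := by
  have hcake : ∀ κ : Measure α, ∫⁻ x, g x ∂κ = ∫⁻ s in Ioo (0 : ℝ) 1, κ {x | s < (g x).toReal} := by
    intro κ
    have h1 : ∫⁻ x, g x ∂κ = ∫⁻ x, ENNReal.ofReal (g x).toReal ∂κ := lintegral_congr fun x =>
      (ENNReal.ofReal_toReal (ne_top_of_le_ne_top ENNReal.one_ne_top (hg1 x))).symm
    rw [h1, lintegral_eq_lintegral_meas_lt κ (Filter.Eventually.of_forall fun x =>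
      ENNReal.toReal_nonneg) hg.ennreal_toReal.aemeasurable,
      ← Ioo_union_Ici_eq_Ioi (zero_lt_one : (0 : ℝ) < 1),
      lintegral_union measurableSet_Ici
        (disjoint_left.2 fun x hx hx' => not_le.2 hx.2 hx')]
    have h2 : ∫⁻ s in Ici (1 : ℝ), κ {x | s < (g x).toReal} = 0 := by
      rw [← lintegral_zero (μ := volume.restrict (Ici (1 : ℝ)))]
      refine setLIntegral_congr_fun measurableSet_Ici fun s hs => ?_
      have : {x | s < (g x).toReal} = ∅ := by
        refine eq_empty_of_forall_notMem fun x hx => ?_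
        have h3 := ENNReal.toReal_mono ENNReal.one_ne_top (hg1 x)
        rw [ENNReal.toReal_one] at h3
        exact absurd (lt_of_lt_of_le hx h3) (not_lt.2 hs)
      simp only [this, measure_empty]
    rw [h2, add_zero]
  rw [hcake, hcake]
  calc ∫⁻ s in Ioo (0 : ℝ) 1, μ {x | s < (g x).toReal}
      ≤ ∫⁻ s in Ioo (0 : ℝ) 1, (ν {x | s < (g x).toReal} + d) := lintegral_mono fun s =>
        h _ (measurableSet_lt measurable_const hg.ennreal_toReal)
    _ = _ := by
      rw [lintegral_add_right _ measurable_const]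
      simp

namespace PistonModel

variable (G : PistonModel)

theorem indicator_one_le (A : Set ℝ) (w : ℝ) : A.indicator (1 : ℝ → ℝ≥0∞) w ≤ 1 :=
  indicator_le (fun _ _ => le_rfl) w

theorem measurable_indicator_one {A : Set ℝ} (hA : MeasurableSet A) :
    Measurable (A.indicator (1 : ℝ → ℝ≥0∞)) := measurable_one.indicator hA

theorem expect_indicator_iUnion {A : ℕ → Set ℝ} (hA : ∀ i, MeasurableSet (A i))
    (hd : Pairwise (Function.onFun Disjoint A)) (t u : ℝ) :
    G.expect ((⋃ i, A i).indicator 1) t u = ∑' i, G.expect ((A i).indicator 1) t u := by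
  rw [← G.expect_tsum fun i => measurable_indicator_one (hA i)]
  congr 1
  funext w
  by_cases hw : ∃ i, w ∈ A i
  · obtain ⟨i, hi⟩ := hw
    rw [indicator_of_mem (mem_iUnion.2 ⟨i, hi⟩), tsum_eq_single i, indicator_of_mem hi]
    exact fun j hj => indicator_of_notMem (disjoint_left.1 (hd hj.symm) hi) _
  · have h0 : ∀ i, (A i).indicator (1 : ℝ → ℝ≥0∞) w = 0 := fun i =>
      indicator_of_notMem (fun hi => hw ⟨i, hi⟩) _
    rw [indicator_of_notMem (fun h => hw (mem_iUnion.1 h))]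
    simp only [h0, tsum_zero]

/-- The distribution at time `t` of a piston started with velocity `u`. -/
def law (t u : ℝ) : Measure ℝ :=
  Measure.ofMeasurable (fun A _ => G.expect (A.indicator 1) t u)
    (by
      have := G.expect_const_mul 0 (φ := fun _ => 0) measurable_const t u
      simpa using this)
    (fun _ hA hd => G.expect_indicator_iUnion hA hd t u)

theorem law_apply (t u : ℝ) {A : Set ℝ} (hA : MeasurableSet A) :
    G.law t u A = G.expect (A.indicator 1) t u :=
  Measure.ofMeasurable_apply A hA

theorem lintegral_law (t u : ℝ) {g : ℝ → ℝ≥0∞} (hg : Measurable g) :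
    ∫⁻ w, g w ∂G.law t u = G.expect g t u := by
  have simple : ∀ f : SimpleFunc ℝ NNReal,
      ∫⁻ w, (f w : ℝ≥0∞) ∂G.law t u = G.expect (fun w => (f w : ℝ≥0∞)) t u := by
    intro f
    induction f using SimpleFunc.induction with
    | @const c A hA =>
      have : ∀ w, ((SimpleFunc.piecewise A hA (SimpleFunc.const ℝ c) (SimpleFunc.const ℝ 0)) w :
          ℝ≥0∞) = c * A.indicator 1 w := by
        intro w
        by_cases hw : w ∈ A <;> simp [hw]
      simp only [this]
      rw [lintegral_const_mul _ (measurable_indicator_one hA), lintegral_indicator_one hA,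
        law_apply _ _ _ hA, G.expect_const_mul _ (measurable_indicator_one hA)]
    | @add f f' _ hf hf' =>
      have hm : Measurable fun w => (f w : ℝ≥0∞) := f.measurable.coe_nnreal_ennreal
      simp only [SimpleFunc.coe_add, Pi.add_apply, ENNReal.coe_add]
      rw [lintegral_add_left hm, hf, hf', G.expect_add hm]
  have hg' : g = fun w => ∑' n, (SimpleFunc.eapproxDiff g n w : ℝ≥0∞) :=
    funext fun w => (SimpleFunc.tsum_eapproxDiff g hg w).symm
  have hm : ∀ n, Measurable fun w => (SimpleFunc.eapproxDiff g n w : ℝ≥0∞) := fun n =>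
    (SimpleFunc.eapproxDiff g n).measurable.coe_nnreal_ennreal
  conv_lhs => rw [hg']
  conv_rhs => rw [hg']
  rw [lintegral_tsum fun n => (hm n).aemeasurable, G.expect_tsum hm]
  exact tsum_congr fun n => simple _

/-- The common limit of the expectations of `φ (W t)` as `t` tends to infinity. -/
def limExpect (φ : ℝ → ℝ≥0∞) : ℝ≥0∞ := ⨆ n : ℕ, ⨅ w : G.states, G.expect φ n w

variable {G}

theorem zero_mem_states : (0 : ℝ) ∈ G.states :=
  ⟨neg_nonpos.2 G.Vbar_pos.le, G.Vbar_pos.le⟩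

theorem Mixing.expect_le_expect_later {C γ : ℝ} (hmix : G.Mixing C γ) (h : G.SingleReflection)
    {φ : ℝ → ℝ≥0∞} (hφ : Measurable φ) (hφ1 : ∀ w ∈ G.states, φ w ≤ 1) {s t : ℝ} (ht : 0 ≤ t)
    (hs : t ≤ s) {u u' : ℝ} (hu : u ∈ G.states) (hu' : u' ∈ G.states) :
    G.expect φ t u ≤ G.expect φ s u' + ENNReal.ofReal (C * Real.exp (-γ * t)) := by
  have hst : 0 ≤ s - t := sub_nonneg.2 hs
  set d := ENNReal.ofReal (C * Real.exp (-γ * t))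
  have h1 : G.expect φ s u' = G.expect (G.expect φ t) (s - t) u' := by
    rw [← G.expect_time_add hφ hst ht, sub_add_cancel]
  have h2 : G.expect (fun w => G.expect φ t w + d) (s - t) u' = G.expect φ s u' + d := by
    rw [G.expect_add (G.measurable_expect hφ t), ← h1, h.expect_const _ hst hu']
  rw [← h2, ← h.expect_const (G.expect φ t u) hst hu']
  exact h.expect_mono (fun w hw => hmix φ hφ hφ1 t ht u hu w hw) _ hu'

theorem Mixing.expect_later_le_expect {C γ : ℝ} (hmix : G.Mixing C γ) (h : G.SingleReflection)
    {φ : ℝ → ℝ≥0∞} (hφ : Measurable φ) (hφ1 : ∀ w ∈ G.states, φ w ≤ 1) {s t : ℝ} (ht : 0 ≤ t)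
    (hs : t ≤ s) {u u' : ℝ} (hu : u ∈ G.states) (hu' : u' ∈ G.states) :
    G.expect φ s u' ≤ G.expect φ t u + ENNReal.ofReal (C * Real.exp (-γ * t)) := by
  have hst : 0 ≤ s - t := sub_nonneg.2 hs
  have h1 : G.expect φ s u' = G.expect (G.expect φ t) (s - t) u' := by
    rw [← G.expect_time_add hφ hst ht, sub_add_cancel]
  rw [h1, ← h.expect_const (G.expect φ t u + _) hst hu']
  exact h.expect_mono (fun w hw => hmix φ hφ hφ1 t ht w hw u hu) _ hu'

theorem Mixing.expect_le_limExpect {C γ : ℝ} (hmix : G.Mixing C γ) (h : G.SingleReflection)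
    {φ : ℝ → ℝ≥0∞} (hφ : Measurable φ) (hφ1 : ∀ w ∈ G.states, φ w ≤ 1) {t : ℝ} (ht : 0 ≤ t)
    {u : ℝ} (hu : u ∈ G.states) :
    G.expect φ t u ≤ G.limExpect φ + ENNReal.ofReal (C * Real.exp (-γ * t)) := by
  obtain ⟨n, hn⟩ := exists_nat_ge t
  have h1 : G.expect φ t u ≤ (⨅ w : G.states, G.expect φ n w) +
      ENNReal.ofReal (C * Real.exp (-γ * t)) := by
    rw [ENNReal.iInf_add]
    exact le_iInf fun w => hmix.expect_le_expect_later h hφ hφ1 ht hn hu w.2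
  exact h1.trans (add_le_add_left (le_iSup (fun n : ℕ => ⨅ w : G.states, G.expect φ n w) n) _)

theorem Mixing.limExpect_le_expect {C γ : ℝ} (hmix : G.Mixing C γ) (h : G.SingleReflection)
    {φ : ℝ → ℝ≥0∞} (hφ : Measurable φ) (hφ1 : ∀ w ∈ G.states, φ w ≤ 1) {t : ℝ} (ht : 0 ≤ t)
    {u : ℝ} (hu : u ∈ G.states) :
    G.limExpect φ ≤ G.expect φ t u + ENNReal.ofReal (C * Real.exp (-γ * t)) := by
  refine iSup_le fun n => ?_
  rcases le_total t n with hn | hn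
  · exact (iInf_le _ ⟨u, hu⟩).trans (hmix.expect_later_le_expect h hφ hφ1 ht hn hu hu)
  -- An expectation at a later time averages those at time n, so it is at least their infimum,
  -- without error.
  · refine le_trans ?_ le_self_add
    have hst : 0 ≤ t - n := sub_nonneg.2 hn
    have h1 : G.expect φ t u = G.expect (G.expect φ n) (t - n) u := by
      rw [← G.expect_time_add hφ hst (Nat.cast_nonneg n), sub_add_cancel]
    rw [h1, ← h.expect_const (⨅ w : G.states, G.expect φ n w) hst hu]
    exact h.expect_mono (fun w hw => iInf_le (fun w : G.states => G.expect φ n w) ⟨w, hw⟩) _ hu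

open Filter Topology in
theorem tendsto_ofReal_exp_decay (C : ℝ) {γ : ℝ} (hγ : 0 < γ) :
    Tendsto (fun t : ℝ => ENNReal.ofReal (C * Real.exp (-γ * t))) atTop (𝓝 0) := by
  have h1 : Tendsto (fun t : ℝ => C * Real.exp (-γ * t)) atTop (𝓝 (C * 0)) := by
    refine Tendsto.const_mul C (Real.tendsto_exp_atBot.comp ?_)
    exact tendsto_id.const_mul_atTop_of_neg (neg_neg_of_pos hγ)
  rw [mul_zero] at h1
  simpa using ENNReal.tendsto_ofReal h1

open Filter Topology in
theorem Mixing.tendsto_expect {C γ : ℝ} (hmix : G.Mixing C γ) (h : G.SingleReflection)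
    (hγ : 0 < γ) {φ : ℝ → ℝ≥0∞} (hφ : Measurable φ) (hφ1 : ∀ w ∈ G.states, φ w ≤ 1) {u : ℝ}
    (hu : u ∈ G.states) : Tendsto (fun t => G.expect φ t u) atTop (𝓝 (G.limExpect φ)) := by
  have hd := tendsto_ofReal_exp_decay C hγ
  have hlim : G.limExpect φ ≠ ⊤ := by
    refine ne_top_of_le_ne_top ?_ (hmix.limExpect_le_expect h hφ hφ1 le_rfl hu)
    exact ENNReal.add_ne_top.2 ⟨ne_top_of_le_ne_top ENNReal.one_ne_top
      (h.expect_le_one hφ1 le_rfl hu), ENNReal.ofReal_ne_top⟩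
  refine tendsto_of_tendsto_of_tendsto_of_le_of_le'
    (g := fun t => G.limExpect φ - ENNReal.ofReal (C * Real.exp (-γ * t)))
    (h := fun t => G.limExpect φ + ENNReal.ofReal (C * Real.exp (-γ * t))) ?_ ?_ ?_ ?_
  · have := ENNReal.Tendsto.sub (tendsto_const_nhds (x := G.limExpect φ)) hd (Or.inl hlim)
    rwa [tsub_zero] at this
  · have := (tendsto_const_nhds (x := G.limExpect φ)).add hd
    rwa [add_zero] at this
  · filter_upwards [eventually_ge_atTop 0] with t ht
    exact tsub_le_iff_right.2 (hmix.limExpect_le_expect h hφ hφ1 ht hu)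
  · filter_upwards [eventually_ge_atTop 0] with t ht
    exact hmix.expect_le_limExpect h hφ hφ1 ht hu

-- The error at time t is the same for all finite partial unions. Countable additivity at time t
-- therefore passes to the limits up to two such errors, which vanish as t grows.
open Filter Topology in
theorem Mixing.limExpect_iUnion {C γ : ℝ} (hmix : G.Mixing C γ) (h : G.SingleReflection)
    (hγ : 0 < γ) {A : ℕ → Set ℝ} (hA : ∀ i, MeasurableSet (A i))
    (hd : Pairwise (Function.onFun Disjoint A)) :
    G.limExpect ((⋃ i, A i).indicator 1) = ∑' i, G.limExpect ((A i).indicator 1) := by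
  have h0 := zero_mem_states (G := G)
  have hone : ∀ B : Set ℝ, ∀ w ∈ G.states, B.indicator (1 : ℝ → ℝ≥0∞) w ≤ 1 :=
    fun B w _ => indicator_one_le B w
  have hAU := measurable_indicator_one (MeasurableSet.iUnion hA)
  have hfin : ∀ k, Tendsto (fun t => ∑ i ∈ Finset.range k, G.expect ((A i).indicator 1) t 0) atTop
      (𝓝 (∑ i ∈ Finset.range k, G.limExpect ((A i).indicator 1))) := fun k =>
    tendsto_finsetSum _ fun i _ =>
      hmix.tendsto_expect h hγ (measurable_indicator_one (hA i)) (hone _) h0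
  refine le_antisymm ?_ ?_
  · have hdec := tendsto_ofReal_exp_decay C hγ
    have hbound : ∀ t : ℝ, 0 ≤ t → G.limExpect ((⋃ i, A i).indicator 1) ≤
        ∑' i, G.limExpect ((A i).indicator 1) +
          (ENNReal.ofReal (C * Real.exp (-γ * t)) + ENNReal.ofReal (C * Real.exp (-γ * t))) := by
      intro t ht
      refine (hmix.limExpect_le_expect h hAU (hone _) ht h0).trans ?_
      rw [← add_assoc]
      refine add_le_add_left ?_ _
      rw [G.expect_indicator_iUnion hA hd]
      refine le_of_tendsto' (ENNReal.tendsto_nat_tsum _) fun k => ?_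
      set B := ⋃ i ∈ Finset.range k, A i
      have hBm : MeasurableSet B := Finset.measurableSet_biUnion _ fun i _ => hA i
      have hB : ∀ t u, G.expect (B.indicator 1) t u =
          ∑ i ∈ Finset.range k, G.expect ((A i).indicator 1) t u := by
        intro t u
        rw [← G.law_apply t u hBm, measure_biUnion_finset (fun i _ j _ hij => hd hij)
          fun i _ => hA i]
        exact Finset.sum_congr rfl fun i _ => G.law_apply t u (hA i)
      have hBlim : G.limExpect (B.indicator 1) =
          ∑ i ∈ Finset.range k, G.limExpect ((A i).indicator 1) := by
        refine tendsto_nhds_unique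
          (hmix.tendsto_expect h hγ (measurable_indicator_one hBm) (hone _) h0) ?_
        exact (hfin k).congr fun t => (hB t 0).symm
      rw [← hB]
      refine (hmix.expect_le_limExpect h (measurable_indicator_one hBm) (hone _) ht h0).trans ?_
      rw [hBlim]
      exact add_le_add_left (ENNReal.sum_le_tsum _) _
    have hlim := (tendsto_const_nhds (x := ∑' i, G.limExpect ((A i).indicator 1))).add
      (hdec.add hdec)
    rw [add_zero, add_zero] at hlim
    refine ge_of_tendsto hlim ?_
    filter_upwards [eventually_ge_atTop 0] with t ht using hbound t ht
  · refine le_of_tendsto' (ENNReal.tendsto_nat_tsum _) fun k => ?_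
    refine le_of_tendsto_of_tendsto' (hfin k)
      (hmix.tendsto_expect h hγ hAU (hone _) h0) fun t => ?_
    rw [G.expect_indicator_iUnion hA hd]
    exact ENNReal.sum_le_tsum _

theorem Mixing.exists_stationary {C γ : ℝ} (hmix : G.Mixing C γ) (h : G.SingleReflection)
    (hγ : 0 < γ) : ∃ μ₀ : Measure ℝ, G.IsStationary μ₀ ∧
      ∀ A, MeasurableSet A → μ₀ A = G.limExpect (A.indicator 1) := by
  have h0 := zero_mem_states (G := G)
  have hempty : G.limExpect ((∅ : Set ℝ).indicator 1) = 0 := by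
    have := hmix.limExpect_iUnion h hγ (A := fun _ => ∅) (fun _ => MeasurableSet.empty)
      (fun i j _ => by simp [Function.onFun])
    simp only [iUnion_empty] at this
    by_contra hne
    -- Additivity over countably many empty sets leaves only the values 0 and ∞, and ∞ is excluded
    -- by the comparison at time 0.
    rw [ENNReal.tsum_const_eq_top_of_ne_zero hne] at this
    have hle := hmix.limExpect_le_expect h (φ := (∅ : Set ℝ).indicator 1)
      (measurable_indicator_one MeasurableSet.empty) (fun w _ => indicator_one_le _ w) le_rfl h0
    rw [this, top_le_iff, ENNReal.add_eq_top] at hle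
    rcases hle with hle | hle
    · have := h.expect_le_one (φ := (∅ : Set ℝ).indicator 1)
        (fun w _ => indicator_one_le _ w) le_rfl h0
      rw [hle] at this
      exact absurd this (by simp)
    · exact ENNReal.ofReal_ne_top hle
  set μ₀ : Measure ℝ := Measure.ofMeasurable (fun A _ => G.limExpect (A.indicator 1)) hempty
    (fun A hA hd => hmix.limExpect_iUnion h hγ hA hd) with hμ₀
  have happ : ∀ A, MeasurableSet A → μ₀ A = G.limExpect (A.indicator 1) := fun A hA =>
    Measure.ofMeasurable_apply A hA
  have hlim : ∀ A, MeasurableSet A → ∀ u ∈ G.states,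
      Filter.Tendsto (fun t => G.expect (A.indicator 1) t u) Filter.atTop (nhds (μ₀ A)) := by
    intro A hA u hu
    rw [happ A hA]
    exact hmix.tendsto_expect h hγ (measurable_indicator_one hA) (fun w _ => indicator_one_le A w) hu
  have hstates : MeasurableSet G.states := measurableSet_Icc
  have huniv : μ₀ univ = 1 := by
    refine tendsto_nhds_unique (hlim univ MeasurableSet.univ 0 h0)
      (tendsto_const_nhds.congr' ?_)
    filter_upwards [Filter.eventually_ge_atTop 0] with t ht
    rw [indicator_univ]
    exact (h.expect_one ht h0).symm
  have hcompl : μ₀ G.statesᶜ = 0 := by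
    refine tendsto_nhds_unique (hlim _ hstates.compl 0 h0)
      (tendsto_const_nhds.congr' ?_)
    filter_upwards [Filter.eventually_ge_atTop 0] with t ht
    refine (le_antisymm ?_ zero_le).symm
    refine (h.expect_mono (ψ := fun _ => 0) (fun w hw => ?_) t h0).trans
      (h.expect_const 0 ht h0).le
    simp [hw]
  refine ⟨μ₀, ⟨⟨⟨huniv⟩, hcompl⟩, fun t ht A hA => ?_⟩, happ⟩
  have hmA := measurable_indicator_one hA
  -- Expectations are known to be at most 1 only on the states; the truncation makes the bound
  -- global and changes nothing μ₀-almost everywhere.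
  set g : ℝ → ℝ≥0∞ := fun w => min (G.expect (A.indicator 1) t w) 1 with hg
  have hgm : Measurable g := (G.measurable_expect hmA t).min measurable_const
  have hgs : ∀ w ∈ G.states, g w = G.expect (A.indicator 1) t w := fun w hw =>
    min_eq_left (h.expect_le_one (fun w _ => indicator_one_le A w) ht hw)
  have hev : G.evolve μ₀ t A = ∫⁻ w, g w ∂μ₀ := by
    refine lintegral_congr_ae ?_
    filter_upwards [measure_eq_zero_iff_ae_notMem.1 hcompl] with w hw
    rw [hgs w (not_not.1 hw), trans_eq]
  have hgt : ∀ s : ℝ, 0 ≤ s → G.expect g s 0 = G.expect (A.indicator 1) (s + t) 0 := by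
    intro s hs
    rw [G.expect_time_add hmA hs ht]
    exact le_antisymm (h.expect_mono (fun w hw => (hgs w hw).le) s h0)
      (h.expect_mono (fun w hw => (hgs w hw).ge) s h0)
  have hshift : Filter.Tendsto (fun s => G.expect g s 0) Filter.atTop (nhds (μ₀ A)) := by
    refine ((hlim A hA 0 h0).comp (Filter.tendsto_atTop_add_const_right _ t
      Filter.tendsto_id)).congr' ?_
    filter_upwards [Filter.eventually_ge_atTop 0] with s hs
    exact (hgt s hs).symm
  have hdec := tendsto_ofReal_exp_decay C hγ
  have hone : ∀ B : Set ℝ, ∀ w ∈ G.states, B.indicator (1 : ℝ → ℝ≥0∞) w ≤ 1 :=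
    fun B w _ => indicator_one_le B w
  rw [hev]
  -- The law at time s from 0 is close to μ₀ on all sets, hence on g, while its integral of g is the
  -- probability of A at time s + t, which tends to μ₀(A).
  refine le_antisymm ?_ ?_
  · have hlim' := hshift.add hdec
    rw [add_zero] at hlim'
    refine ge_of_tendsto hlim' ?_
    filter_upwards [Filter.eventually_ge_atTop 0] with s hs
    rw [← G.lintegral_law s 0 hgm]
    refine lintegral_le_lintegral_add (fun B hB => ?_) hgm fun w => min_le_right _ _
    rw [happ B hB, G.law_apply s 0 hB]
    exact hmix.limExpect_le_expect h (measurable_indicator_one hB) (hone B) hs h0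
  · have hlim' := (tendsto_const_nhds (x := ∫⁻ w, g w ∂μ₀)).add hdec
    rw [add_zero] at hlim'
    refine le_of_tendsto_of_tendsto hshift hlim' ?_
    filter_upwards [Filter.eventually_ge_atTop 0] with s hs
    rw [← G.lintegral_law s 0 hgm]
    refine lintegral_le_lintegral_add (fun B hB => ?_) hgm fun w => min_le_right _ _
    rw [happ B hB, G.law_apply s 0 hB]
    exact hmix.expect_le_limExpect h (measurable_indicator_one hB) (hone B) hs h0

end PistonModel

/-! ### Backward invariant sets of velocities -/

namespace PistonModel

/-- `U` contains the preimages of its points under a collision that shifts the velocity by `α`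
upwards, and under one that shifts it by `β` downwards. -/
structure BackwardInvariant (G : PistonModel) (U : Set ℝ) (α β : ℝ) : Prop where
  lt_up : (1 - G.keep) * G.Vbar < α
  up_lt : α < G.keep * G.Vbar
  lt_down : (1 - G.keep) * G.Vbar < β
  down_lt : β < G.keep * G.Vbar
  up : ∀ u, G.reflect (G.keep * u + α) ∈ U → u ∈ U
  down : ∀ u, G.reflect (G.keep * u - β) ∈ U → u ∈ U

namespace BackwardInvariant

variable {G : PistonModel} {U : Set ℝ} {α β : ℝ}

/-- Reversing velocities exchanges upward and downward kicks, which halves the case analysis. -/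
theorem neg (h : G.BackwardInvariant U α β) : G.BackwardInvariant (-U) β α where
  lt_up := h.lt_down
  up_lt := h.down_lt
  lt_down := h.lt_up
  down_lt := h.up_lt
  up u hu := by
    rw [mem_neg] at hu ⊢
    refine h.down _ ?_
    rwa [show G.keep * -u - β = -(G.keep * u + β) by ring, G.reflect_neg]
  down u hu := by
    rw [mem_neg] at hu ⊢
    refine h.up _ ?_
    rwa [show G.keep * -u + α = -(G.keep * u - α) by ring, G.reflect_neg]

/-- Reflection at `-Vbar` folds the line, so an interval touching `-Vbar` has a preimage from both
sides of the fold, twice as long before the stretching by 1/`keep`. -/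
theorem Ioo_subset_of_Ico (h : G.BackwardInvariant U α β) {r : ℝ} (hr : r ≤ G.Vbar)
    (hU : Ico (-G.Vbar) r ⊆ U) :
    Ioo ((-2 * G.Vbar - r + β) / G.keep) ((r + β) / G.keep) ⊆ U := by
  rintro u ⟨h1, h2⟩
  rw [div_lt_iff₀ G.keep_pos] at h1
  rw [lt_div_iff₀ G.keep_pos] at h2
  refine h.down u (hU ?_)
  rcases lt_or_ge (G.keep * u - β) (-G.Vbar) with hw | hw
  · rw [G.reflect_of_lt hw]
    constructor <;> linarith
  · rw [G.reflect_of_mem hw (by linarith)]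
    constructor <;> linarith

/-- When the preimage of a prefix reaches down past `-Vbar`, it contains a longer prefix. As β
exceeds (1 - `keep`) `Vbar`, each round gains at least a fixed length, so finitely many suffice. -/
theorem Ioo_subset_of_prefix (h : G.BackwardInvariant U α β) {r : ℝ} (hr : r ≤ G.Vbar)
    (hr' : -G.Vbar < r) (hU : Ico (-G.Vbar) r ⊆ U)
    (hlow : (-2 * G.Vbar - r + β) / G.keep < -G.Vbar) : Ioo (-G.Vbar) G.Vbar ⊆ U := by
  have ha := G.keep_pos
  have ha1 := G.keep_lt_one
  have hg : 0 < (β - (1 - G.keep) * G.Vbar) / G.keep := div_pos (sub_pos.2 h.lt_down) ha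
  obtain ⟨n, hn⟩ := exists_nat_ge ((G.Vbar - r) / ((β - (1 - G.keep) * G.Vbar) / G.keep))
  rw [div_le_iff₀ hg] at hn
  induction n generalizing r with
  | zero =>
    have : r = G.Vbar := le_antisymm hr (by simp at hn; linarith)
    rw [← this]
    exact Ioo_subset_Ico_self.trans (by rwa [this] at hU ⊢)
  | succ n ih =>
    have hstep := h.Ioo_subset_of_Ico hr hU
    rcases lt_or_ge G.Vbar ((r + β) / G.keep) with hV | hV
    · exact (Ioo_subset_Ioo hlow.le hV.le).trans hstep
    have hgain : r + (β - (1 - G.keep) * G.Vbar) / G.keep ≤ (r + β) / G.keep := by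
      rw [← sub_nonneg]
      have : (r + β) / G.keep - (r + (β - (1 - G.keep) * G.Vbar) / G.keep) =
          (1 - G.keep) * (r + G.Vbar) / G.keep := by
        field_simp
        ring
      rw [this]
      exact div_nonneg (mul_nonneg (by linarith) (by linarith)) ha.le
    refine ih hV (by linarith) (fun u hu => hstep ⟨by linarith [hu.1], hu.2⟩) ?_ ?_
    · refine lt_of_le_of_lt ?_ hlow
      gcongr
      linarith
    · push_cast at hn
      linarith

/-- The part of an interval above the lowest reachable velocity `α - keep * Vbar` grows. -/
theorem exists_longer_of_half (h : G.BackwardInvariant U α β) {x y : ℝ} (hy : y ≤ G.Vbar)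
    (hU : Ioo x y ⊆ U) (hx : x < α - G.keep * G.Vbar)
    (hhalf : (y - x) / 2 ≤ y - (α - G.keep * G.Vbar)) :
    Ioo (-G.Vbar) G.Vbar ⊆ U ∨ ∃ x' y', -G.Vbar ≤ x' ∧ y' ≤ G.Vbar ∧
      (y - x) / G.keep ≤ y' - x' ∧ Ioo x' y' ⊆ U := by
  have ha := G.keep_pos
  have ha1 := G.keep_lt_one
  have hV := G.Vbar_pos
  have hα := h.lt_up
  have hα' := h.up_lt
  have hβ := h.down_lt
  have haV : G.keep * G.Vbar < G.Vbar := by nlinarith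
  set r := (y - α) / G.keep with hr
  have har : G.keep * r = y - α := by rw [hr]; field_simp
  have hrV : r ≤ G.Vbar := by
    rw [hr, div_le_iff₀ ha]
    linarith
  have hrV' : -G.Vbar < r := by
    rw [hr, lt_div_iff₀ ha]
    linarith
  have hpre : Ico (-G.Vbar) r ⊆ U := by
    rintro u ⟨h1, h2⟩
    have h3 : G.keep * u < y - α := by rw [← har]; gcongr
    have h4 : G.keep * -G.Vbar ≤ G.keep * u := by gcongr
    refine h.up u ?_
    rw [G.reflect_of_mem (by nlinarith) (by linarith)]
    exact hU ⟨by linarith, by linarith⟩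
  have hstep := h.Ioo_subset_of_Ico hrV hpre
  -- If the folded preimage leaves the states below, the prefix grows to everything; if above, it
  -- and the prefix already cover everything. Otherwise the doubling by the fold makes up for
  -- keeping only half of the interval.
  rcases lt_or_ge ((-2 * G.Vbar - r + β) / G.keep) (-G.Vbar) with hlo | hlo
  · exact Or.inl (h.Ioo_subset_of_prefix hrV hrV' hpre hlo)
  rcases lt_or_ge G.Vbar ((r + β) / G.keep) with hhi | hhi
  · left
    have h1 := hhi
    rw [lt_div_iff₀ ha] at h1
    have hr0 : 0 < r := by linarith
    have hlo0 : (-2 * G.Vbar - r + β) / G.keep < 0 :=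
      div_neg_of_neg_of_pos (by linarith) ha
    intro u hu
    rcases lt_or_ge u r with hur | hur
    · exact hpre ⟨hu.1.le, hur⟩
    · exact hstep ⟨by linarith, hu.2.trans hhi⟩
  · refine Or.inr ⟨_, _, hlo, hhi, ?_, hstep⟩
    rw [← sub_div, div_le_div_iff_of_pos_right ha]
    have : (y - x) / 2 ≤ G.keep * (r + G.Vbar) := by rw [mul_add, har]; linarith
    have h1 : G.keep * (r + G.Vbar) ≤ 1 * (r + G.Vbar) :=
      mul_le_mul_of_nonneg_right ha1.le (by linarith)
    linarith

/-- An interval within the range of one unreflected kick has a full preimage among the states,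
longer by 1/`keep`. An interval exceeding both ranges has at least half of its length in one of
them. -/
theorem exists_longer (h : G.BackwardInvariant U α β) {x y : ℝ}
    (hx : -G.Vbar ≤ x) (hy : y ≤ G.Vbar) (hU : Ioo x y ⊆ U) :
    Ioo (-G.Vbar) G.Vbar ⊆ U ∨ ∃ x' y', -G.Vbar ≤ x' ∧ y' ≤ G.Vbar ∧
      (y - x) / G.keep ≤ y' - x' ∧ Ioo x' y' ⊆ U := by
  have ha := G.keep_pos
  have hα := h.lt_up
  have hβ := h.lt_down
  rcases lt_or_ge x (α - G.keep * G.Vbar) with h1 | h1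
  · rcases lt_or_ge (G.keep * G.Vbar - β) y with h2 | h2
    · rcases le_or_gt ((y - x) / 2) (y - (α - G.keep * G.Vbar)) with h3 | h3
      · exact h.exists_longer_of_half hy hU h1 h3
      · have hα' := h.up_lt
        have hβ' := h.down_lt
        have hneg : Ioo (-y) (-x) ⊆ -U := fun u hu => hU ⟨by linarith [hu.2], by linarith [hu.1]⟩
        rcases h.neg.exists_longer_of_half (by linarith) hneg (by linarith)
          (by linarith) with hfull | ⟨x', y', hx', hy', hlen, hsub⟩
        · left
          intro u hu
          have := hfull (show -u ∈ Ioo (-G.Vbar) G.Vbar from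
            ⟨by linarith [hu.2], by linarith [hu.1]⟩)
          simpa using this
        · refine Or.inr ⟨-y', -x', by linarith, by linarith, ?_, fun u hu => ?_⟩
          · convert hlen using 1 <;> ring
          · have := hsub (show -u ∈ Ioo x' y' from ⟨by linarith [hu.2], by linarith [hu.1]⟩)
            simpa using this
    · refine Or.inr ⟨(x + β) / G.keep, (y + β) / G.keep, ?_, ?_, ?_, ?_⟩
      · rw [le_div_iff₀ ha]; linarith
      · rw [div_le_iff₀ ha]; linarith
      · rw [← sub_div, div_le_div_iff_of_pos_right ha]; linarith
      · rintro u ⟨hu1, hu2⟩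
        rw [div_lt_iff₀ ha] at hu1
        rw [lt_div_iff₀ ha] at hu2
        refine h.down u ?_
        rw [G.reflect_of_mem (by linarith) (by linarith)]
        exact hU ⟨by linarith, by linarith⟩
  · refine Or.inr ⟨(x - α) / G.keep, (y - α) / G.keep, ?_, ?_, ?_, ?_⟩
    · rw [le_div_iff₀ ha]; linarith
    · rw [div_le_iff₀ ha]; linarith
    · rw [← sub_div, div_le_div_iff_of_pos_right ha]; linarith
    · rintro u ⟨hu1, hu2⟩
      rw [div_lt_iff₀ ha] at hu1
      rw [lt_div_iff₀ ha] at hu2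
      refine h.up u ?_
      rw [G.reflect_of_mem (by linarith) (by linarith)]
      exact hU ⟨by linarith, by linarith⟩

/-- A backward invariant set that contains an interval of states contains all states in the
interior. -/
theorem Ioo_subset (h : G.BackwardInvariant U α β) {x y : ℝ} (hxy : x < y)
    (hx : -G.Vbar ≤ x) (hy : y ≤ G.Vbar) (hU : Ioo x y ⊆ U) : Ioo (-G.Vbar) G.Vbar ⊆ U := by
  by_contra hnot
  have ha := G.keep_pos
  have key : ∀ n : ℕ, ∃ x' y', -G.Vbar ≤ x' ∧ y' ≤ G.Vbar ∧ (y - x) / G.keep ^ n ≤ y' - x' ∧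
      Ioo x' y' ⊆ U := by
    intro n
    induction n with
    | zero => exact ⟨x, y, hx, hy, by simp, hU⟩
    | succ n ih =>
      obtain ⟨x', y', hx', hy', hlen, hsub⟩ := ih
      rcases h.exists_longer hx' hy' hsub with hfull | ⟨x'', y'', h1, h2, h3, h4⟩
      · exact absurd hfull hnot
      · refine ⟨x'', y'', h1, h2, le_trans ?_ h3, h4⟩
        rw [pow_succ, ← div_div]
        gcongr
  have hV := G.Vbar_pos
  -- Intervals of states cannot be longer than 2 `Vbar`, so the geometric growth of their lengths
  -- must stop.
  obtain ⟨n, hn⟩ := exists_pow_lt_of_lt_one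
    (show 0 < (y - x) / (2 * G.Vbar) from div_pos (sub_pos.2 hxy) (by positivity)) G.keep_lt_one
  obtain ⟨x', y', hx', hy', hlen, -⟩ := key n
  rw [lt_div_iff₀ (by positivity)] at hn
  rw [div_le_iff₀ (pow_pos ha n)] at hlen
  have : (y' - x') * G.keep ^ n ≤ (2 * G.Vbar) * G.keep ^ n := by
    gcongr
    linarith
  linarith

end BackwardInvariant
end PistonModel

/-! ### Absolute continuity and support of stationary measures -/

namespace PistonModel

variable {G : PistonModel}

/-- As a function of the atom's velocity the jump is piecewise affine with slopes ± `kick`, and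
affine maps of nonzero slope pull null sets back to null sets. -/
theorem volume_jump_preimage_eq_zero (G : PistonModel) {A : Set ℝ} (hA : volume A = 0) (u : ℝ) :
    volume {v | G.jump u v ∈ A} = 0 := by
  have hb := G.kick_pos.ne'
  have haff : ∀ B : Set ℝ, volume B = 0 → volume {v | G.collide u v ∈ B} = 0 := by
    intro B hB
    have : {v | G.collide u v ∈ B} =
        (fun v => G.kick * v) ⁻¹' ((fun w => G.keep * u + w) ⁻¹' B) := rfl
    rw [this, Real.volume_preimage_mul_left hb, measure_preimage_add, hB, mul_zero]
  have hrefl : ∀ x : ℝ, volume {w | x - w ∈ A} = 0 := by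
    intro x
    have : {w | x - w ∈ A} = Neg.neg ⁻¹' ((fun w => x + w) ⁻¹' A) := by
      ext w
      simp [sub_eq_add_neg]
    rw [this, Measure.measure_preimage_neg, measure_preimage_add, hA]
  refine measure_mono_null ?_ (measure_union_null (haff A hA)
    (measure_union_null (haff _ (hrefl (2 * G.Vbar))) (haff _ (hrefl (-2 * G.Vbar)))))
  intro v hv
  change G.reflect (G.collide u v) ∈ A at hv
  unfold reflect at hv
  split_ifs at hv
  · exact Or.inr (Or.inl hv)
  · exact Or.inr (Or.inr hv)
  · exact Or.inl hv

theorem expectN_succ_eq_zero (G : PistonModel) {A : Set ℝ} (hA : volume A = 0) (n : ℕ) (t u : ℝ) :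
    G.expectN (A.indicator 1) (n + 1) t u = 0 := by
  have hhit : ∀ r u, G.hit (G.expectN (A.indicator 1) n r) u = 0 := by
    induction n with
    | zero =>
      intro r u
      unfold hit
      rw [← lintegral_zero (μ := (volume : Measure ℝ))]
      refine lintegral_congr_ae ?_
      filter_upwards [measure_eq_zero_iff_ae_notMem.1
        (G.volume_jump_preimage_eq_zero hA u)] with v hv
      have : G.jump u v ∉ A := hv
      rw [expectN_zero, indicator_of_notMem this, mul_zero, mul_zero]
    | succ n ih =>
      intro r u
      have : G.expectN (A.indicator 1) (n + 1) r = fun _ => 0 := by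
        funext w
        simp [expectN_succ, ih]
      rw [this, hit_const, mul_zero]
  simp [expectN_succ, hhit]

theorem IsStationary.ae_mem_states {μ : Measure ℝ} (hμ : G.IsStationary μ) :
    ∀ᵐ u ∂μ, u ∈ G.states := by
  filter_upwards [measure_eq_zero_iff_ae_notMem.1 hμ.1.2] with u hu using not_not.1 hu

theorem IsCore.exists_le_totalRate {K : Set ℝ} {c : ℝ} (hK : G.IsCore K c) :
    ∃ r > 0, ∀ u ∈ G.states, r ≤ G.totalRate u := by
  have hfin : ENNReal.ofReal c * volume K ≠ ⊤ :=
    ENNReal.mul_ne_top ENNReal.ofReal_ne_top hK.isCompact.measure_lt_top.ne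
  refine ⟨(ENNReal.ofReal c * volume K).toReal, ENNReal.toReal_pos ?_ hfin, fun u hu => ?_⟩
  · exact mul_ne_zero (by simpa using hK.pos) hK.volume_pos.ne'
  · rw [← ENNReal.ofReal_le_ofReal_iff (G.totalRate_nonneg u), ENNReal.ofReal_toReal hfin,
      ofReal_totalRate, ← setLIntegral_const]
    exact (setLIntegral_mono' hK.isCompact.measurableSet fun v hv => hK.le_rate u hu v hv).trans
      (setLIntegral_le_lintegral _ _)

/-- At time 1 a null set is charged only by trajectories without a collision, whose probability is
at most exp(-r) < 1; stationarity then forces the mass to be 0. -/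
theorem IsStationary.absolutelyContinuous {μ : Measure ℝ} (hμ : G.IsStationary μ) :
    μ ≪ volume := by
  have := hμ.1.1
  obtain ⟨K, c, hK, -⟩ := G.exists_isCore_left
  obtain ⟨r, hr, hrate⟩ := hK.exists_le_totalRate
  refine Measure.AbsolutelyContinuous.mk fun A hA hA0 => ?_
  have h1 : μ A ≤ ENNReal.ofReal (Real.exp (-r)) * μ A := by
    rw [← lintegral_indicator_one hA,
      ← lintegral_const_mul _ (measurable_indicator_one hA), lintegral_indicator_one hA,
      ← hμ.2 1 zero_le_one A hA]
    refine lintegral_mono_ae ?_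
    filter_upwards [hμ.ae_mem_states] with u hu
    rw [trans_eq, expect, tsum_eq_single 0]
    · rw [expectN_zero]
      gcongr
      linarith [hrate u hu]
    · intro n hn
      obtain ⟨k, rfl⟩ := Nat.exists_eq_succ_of_ne_zero hn
      exact G.expectN_succ_eq_zero hA0 k 1 u
  by_contra hne
  have hlt : ENNReal.ofReal (Real.exp (-r)) < 1 := by
    rw [ENNReal.ofReal_lt_one, Real.exp_lt_one_iff]
    linarith
  have := ENNReal.mul_lt_mul_left hne (measure_ne_top μ A) hlt
  rw [one_mul] at this
  exact absurd h1 (not_le.2 this)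

theorem IsStationary.hitWeight_mul_le {μ : Measure ℝ} (hμ : G.IsStationary μ)
    (h : G.SingleReflection) {K : Set ℝ} {c : ℝ} (hK : G.IsCore K c) {A : Set ℝ}
    (hA : MeasurableSet A) :
    G.hitWeight c * ∫⁻ v in K, μ {u | G.jump u v ∈ A} ≤ μ A := by
  have := hμ.1.1
  have hm : Measurable fun p : ℝ × ℝ => A.indicator (1 : ℝ → ℝ≥0∞) (G.jump p.1 p.2) :=
    (measurable_indicator_one hA).comp G.measurable_jump
  have hslice : ∀ v, μ {u | G.jump u v ∈ A} = ∫⁻ u, A.indicator 1 (G.jump u v) ∂μ := by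
    intro v
    have hs : MeasurableSet {u | G.jump u v ∈ A} :=
      hA.preimage (G.measurable_jump.comp measurable_prodMk_right)
    rw [← lintegral_indicator_one hs]
    rfl
  simp only [hslice]
  rw [lintegral_lintegral_swap (f := fun v u => A.indicator 1 (G.jump u v))
      (hm.comp measurable_swap).aemeasurable,
    ← lintegral_const_mul _ (Measurable.lintegral_prod_right' hm), ← hμ.2 1 zero_le_one A hA]
  refine lintegral_mono_ae ?_
  filter_upwards [hμ.ae_mem_states] with u hu
  rw [trans_eq]
  exact h.hitWeight_mul_le_expect hK (measurable_indicator_one hA) hu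

/-- Stationarity makes the preimage null for almost every v in K, and K has positive volume. -/
theorem IsStationary.exists_null_preimage {μ : Measure ℝ} (hμ : G.IsStationary μ)
    (h : G.SingleReflection) {K : Set ℝ} {c : ℝ} (hK : G.IsCore K c) {A : Set ℝ}
    (hA : MeasurableSet A) (hA0 : μ A = 0) : ∃ v ∈ K, μ {u | G.jump u v ∈ A} = 0 := by
  have := hμ.1.1
  have h1 := hμ.hitWeight_mul_le h hK hA
  rw [hA0, nonpos_iff_eq_zero, mul_eq_zero, or_iff_right (hitWeight_pos hK.pos).ne'] at h1
  have hm : Measurable fun v => μ {u | G.jump u v ∈ A} :=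
    measurable_measure_prodMk_right (hA.preimage G.measurable_jump)
  rw [lintegral_eq_zero_iff hm, Filter.EventuallyEq,
    ae_restrict_iff' hK.isCompact.measurableSet] at h1
  by_contra! hno
  refine hK.volume_pos.ne' (measure_mono_null ?_ h1)
  intro v hv hcon
  exact hno v hv (hcon hv)

/-- The support of a stationary measure is the whole state space if the piston is heavy. -/
theorem IsStationary.Ioo_subset_support {μ : Measure ℝ} (hμ : G.IsStationary μ)
    (h : G.SingleReflection) (hheavy : G.kick * G.vmax ≤ G.keep * G.Vbar) :
    Ioo (-G.Vbar) G.Vbar ⊆ μ.support := by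
  have := hμ.1.1
  obtain ⟨K, c, hK, hKmin⟩ := G.exists_isCore_left
  obtain ⟨K', c', hK', hKmin'⟩ := G.exists_isCore_right
  have hopen : IsOpen μ.supportᶜ := Measure.isOpen_compl_support
  have hnull : μ μ.supportᶜ = 0 := Measure.measure_compl_support
  obtain ⟨v, hv, hv0⟩ := hμ.exists_null_preimage h hK hopen.measurableSet hnull
  obtain ⟨v', hv', hv0'⟩ := hμ.exists_null_preimage h hK' hopen.measurableSet hnull
  have hb := G.kick_pos
  have hab := G.keep_add_kick
  have hV := G.Vbar_lt_vmin
  have hlow : ∀ x, G.vmin < x → (1 - G.keep) * G.Vbar < G.kick * x := by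
    intro x hx
    rw [show 1 - G.keep = G.kick by linarith]
    exact mul_lt_mul_of_pos_left (hV.trans hx) hb
  have hup : ∀ x, |x| < G.vmax → G.kick * |x| < G.keep * G.Vbar := fun x hx =>
    (mul_lt_mul_of_pos_left hx hb).trans_le hheavy
  -- The preimage is open by continuity of the jump, including the reflection; an open null set
  -- misses the support.
  have hsub : ∀ x, μ {u | G.jump u x ∈ μ.supportᶜ} = 0 →
      ∀ u, G.jump u x ∈ μ.supportᶜ → u ∈ μ.supportᶜ := by
    intro x hx u hu
    refine Measure.subset_compl_support_of_isOpen ?_ hx hu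
    exact hopen.preimage (G.continuous_jump.comp (by fun_prop : Continuous fun u => (u, x)))
  have hinv : G.BackwardInvariant μ.supportᶜ (G.kick * v) (-(G.kick * v')) :=
    { lt_up := hlow v (hKmin v hv)
      up_lt := by
        have := hup v (hK.abs_lt v hv)
        have h2 := mul_le_mul_of_nonneg_left (le_abs_self v) hb.le
        linarith
      lt_down := by
        have := hlow (-v') (by linarith [hKmin' v' hv'])
        linarith
      down_lt := by
        have := hup v' (hK'.abs_lt v' hv')
        have h2 := mul_le_mul_of_nonneg_left (neg_abs_le v') hb.le
        linarith
      up := fun u hu => hsub v hv0 u hu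
      down := fun u hu => by
        rw [sub_neg_eq_add] at hu
        exact hsub v' hv0' u hu }
  intro w hw
  by_contra hws
  obtain ⟨l, r, hlr, hsubs⟩ := mem_nhds_iff_exists_Ioo_subset.1
    ((hopen.inter isOpen_Ioo).mem_nhds ⟨hws, hw⟩)
  have hfull := hinv.Ioo_subset (x := max l (-G.Vbar)) (y := min r G.Vbar)
    (max_lt (lt_min (hlr.1.trans hlr.2) (hlr.1.trans hw.2))
      (lt_min (hw.1.trans hlr.2) (by linarith [G.Vbar_pos])))
    (le_max_right _ _) (min_le_right _ _)
    fun z hz => (hsubs ⟨(le_max_left _ _).trans_lt hz.1, hz.2.trans_le (min_le_left _ _)⟩).1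
  have hzero : μ univ = 0 := by
    refine measure_mono_null (t := G.statesᶜ ∪ (μ.supportᶜ ∪ {-G.Vbar, G.Vbar})) ?_ ?_
    · intro z _
      by_cases hz : z ∈ G.states
      · right
        rcases hz.1.eq_or_lt with h1 | h1
        · right; left; exact h1.symm
        rcases hz.2.eq_or_lt with h2 | h2
        · right; right; exact h2
        · left; exact hfull ⟨h1, h2⟩
      · exact Or.inl hz
    · refine measure_union_null hμ.1.2 (measure_union_null hnull ?_)
      exact hμ.absolutelyContinuous ((Set.toFinite _).measure_zero volume)
  rw [measure_univ] at hzero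
  exact one_ne_zero hzero

end PistonModel

/-! ### Lower bound on the stationary density -/

theorem lintegral_measure_slice_swap {α β : Type*} [MeasurableSpace α] [MeasurableSpace β]
    (μ : Measure α) (ν : Measure β) [SFinite μ] [SFinite ν] {S : Set (α × β)}
    (hS : MeasurableSet S) :
    ∫⁻ y, μ {x | (x, y) ∈ S} ∂ν = ∫⁻ x, ν {y | (x, y) ∈ S} ∂μ :=
  (Measure.prod_apply_symm hS).symm.trans (Measure.prod_apply hS)

/-- A measure with a density that exceeds a multiple of the reference measure has a density that
exceeds a constant everywhere. -/
theorem exists_density_ge {α : Type*} [MeasurableSpace α] {μ ν : Measure α} [IsFiniteMeasure μ]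
    [IsFiniteMeasure ν] (hμ : μ ≪ ν) {c : ℝ≥0∞} (hc : c ≠ ⊤) (h : c • ν ≤ μ) :
    ∃ f : α → ℝ≥0∞, Measurable f ∧ μ = ν.withDensity f ∧ ∀ x, c ≤ f x := by
  have hfin : IsFiniteMeasure (c • ν) := Measure.smul_finite ν hc
  have hsub : μ - c • ν ≪ ν := (Measure.absolutelyContinuous_of_le Measure.sub_le).trans hμ
  -- Adding c to the density of the difference makes the bound hold at every point and not merely
  -- almost everywhere.
  refine ⟨fun x => (μ - c • ν).rnDeriv ν x + c,
    (Measure.measurable_rnDeriv _ _).add_const c, ?_, fun x => le_add_self⟩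
  have : (fun x => (μ - c • ν).rnDeriv ν x + c) = (μ - c • ν).rnDeriv ν + fun _ => c := rfl
  rw [this, withDensity_add_left (Measure.measurable_rnDeriv _ _),
    Measure.withDensity_rnDeriv_eq _ _ hsub, withDensity_const, Measure.sub_add_cancel_of_le h]

namespace PistonModel

variable {G : PistonModel}

theorem measurableSet_source (G : PistonModel) {K : Set ℝ} (hK : MeasurableSet K) :
    MeasurableSet {p : ℝ × ℝ | (p.2 - G.keep * p.1) / G.kick ∈ K} := by
  have : Measurable fun p : ℝ × ℝ => (p.2 - G.keep * p.1) / G.kick := by fun_prop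
  exact hK.preimage this

theorem volume_source (G : PistonModel) (K : Set ℝ) (y : ℝ) :
    volume {u | (y - G.keep * u) / G.kick ∈ K} =
      ENNReal.ofReal |(-(G.keep / G.kick))⁻¹| * volume K := by
  have hc : -(G.keep / G.kick) ≠ 0 := neg_ne_zero.2 (div_pos G.keep_pos G.kick_pos).ne'
  have : {u | (y - G.keep * u) / G.kick ∈ K} =
      (fun u => -(G.keep / G.kick) * u) ⁻¹' ((fun w => y / G.kick + w) ⁻¹' K) := by
    ext u
    simp only [mem_preimage, mem_ofPred_eq]
    rw [show y / G.kick + -(G.keep / G.kick) * u = (y - G.keep * u) / G.kick by ring]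
  rw [this, Real.volume_preimage_mul_left hc, measure_preimage_add]

theorem volume_source_pos {K : Set ℝ} {c : ℝ} (hK : G.IsCore K c) (y : ℝ) :
    0 < volume {u | (y - G.keep * u) / G.kick ∈ K} := by
  rw [volume_source]
  refine ENNReal.mul_pos ?_ hK.volume_pos.ne'
  simpa using ⟨G.kick_pos.ne', G.keep_pos.ne'⟩

/-- The density of a stationary measure at `y` is at least a multiple of the mass of the
velocities from which `y` is reached by a collision with an atom from a core. -/
theorem IsStationary.lintegral_source_le {μ : Measure ℝ} (hμ : G.IsStationary μ)
    (h : G.SingleReflection) {K : Set ℝ} {c : ℝ} (hK : G.IsCore K c) {A : Set ℝ}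
    (hA : MeasurableSet A) (hAs : A ⊆ G.states) :
    G.hitWeight c * ENNReal.ofReal |G.kick⁻¹| *
      ∫⁻ y in A, μ {u | (y - G.keep * u) / G.kick ∈ K} ≤ μ A := by
  have := hμ.1.1
  have hKm := hK.isCompact.measurableSet
  have hb := G.kick_pos.ne'
  refine le_trans (le_of_eq ?_) ((mul_le_mul_right (lintegral_mono fun v => measure_mono
    (s := {u | G.keep * u + G.kick * v ∈ A}) fun u hu => ?_) _).trans
    (hμ.hitWeight_mul_le h hK hA))
  · have hS := G.measurableSet_source hKm
    have hS' : MeasurableSet {p : ℝ × ℝ | G.keep * p.1 + G.kick * p.2 ∈ A} := by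
      have : Measurable fun p : ℝ × ℝ => G.keep * p.1 + G.kick * p.2 := by fun_prop
      exact hA.preimage this
    have e1 := lintegral_measure_slice_swap μ (volume.restrict A) hS
    have e2 := lintegral_measure_slice_swap μ (volume.restrict K) hS'
    simp only [mem_ofPred_eq] at e1 e2
    have hm : Measurable fun u => volume.restrict A {y | (y - G.keep * u) / G.kick ∈ K} :=
      measurable_measure_prodMk_left hS
    rw [e1, e2, mul_assoc, ← lintegral_const_mul _ hm]
    congr 2 with u
    have m1 : MeasurableSet {y | (y - G.keep * u) / G.kick ∈ K} :=
      hS.preimage measurable_prodMk_left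
    have m2 : MeasurableSet {v | G.keep * u + G.kick * v ∈ A} :=
      hS'.preimage measurable_prodMk_left
    -- For fixed u the substitution y = `keep` u + `kick` v matches the two slices; its Jacobian is
    -- the factor |`kick`⁻¹|.
    rw [Measure.restrict_apply m1, Measure.restrict_apply m2,
      ← measure_preimage_add volume (G.keep * u) ({y | (y - G.keep * u) / G.kick ∈ K} ∩ A),
      ← Real.volume_preimage_mul_left hb]
    refine congrArg (volume : Measure ℝ) (Set.ext fun v => ?_)
    simp only [mem_preimage, mem_inter_iff, mem_ofPred_eq, add_sub_cancel_left]
    rw [mul_div_cancel_left₀ v hb, and_comm]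
  · have hw := hAs hu
    change G.reflect (G.keep * u + G.kick * v) ∈ A
    rwa [G.reflect_of_mem hw.1 hw.2]

/-- All the velocities from which `I` is reached without reflection by a collision with an atom
from `K` lie in the interior of the state space. -/
def Reachable (G : PistonModel) (I K : Set ℝ) : Prop :=
  ∀ y ∈ I, ∀ u, (y - G.keep * u) / G.kick ∈ K → u ∈ Ioo (-G.Vbar) G.Vbar

/-- Let H(u) be the volume of the part of A reached from u by a core atom. It is lower
semicontinuous with μ-integral 0, so {H > 0} is open and null and misses the support; by
reachability it also lies inside the support, hence is empty. Integrating H = 0 against Lebesgue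
measure gives a positive multiple of the volume of A. -/
theorem IsStationary.volume_eq_zero {μ : Measure ℝ} (hμ : G.IsStationary μ)
    (h : G.SingleReflection) (hsupp : Ioo (-G.Vbar) G.Vbar ⊆ μ.support) {I K : Set ℝ} {c : ℝ}
    (hK : G.IsCore K c) (hI : G.Reachable I K) {A : Set ℝ} (hA : MeasurableSet A)
    (hAs : A ⊆ G.states) (hAI : A ⊆ I) (hA0 : μ A = 0) : volume A = 0 := by
  have := hμ.1.1
  have hKm := hK.isCompact.measurableSet
  have hb := G.kick_pos
  have hfin : IsFiniteMeasure (volume.restrict A) :=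
    ⟨by simpa using (measure_mono hAs).trans_lt isCompact_Icc.measure_lt_top⟩
  set H : ℝ → ℝ≥0∞ := fun u => volume.restrict A {y | (y - G.keep * u) / G.kick ∈ K} with hH
  have hS := G.measurableSet_source hKm
  have hHm : Measurable H := measurable_measure_prodMk_left hS
  have swap : ∀ κ : Measure ℝ, SFinite κ →
      ∫⁻ y in A, κ {u | (y - G.keep * u) / G.kick ∈ K} = ∫⁻ u, H u ∂κ := fun κ _ =>
    lintegral_measure_slice_swap κ (volume.restrict A) hS
  have hμH : ∫⁻ u, H u ∂μ = 0 := by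
    have h1 := hμ.lintegral_source_le h hK hA hAs
    rw [hA0, nonpos_iff_eq_zero, swap μ inferInstance, mul_eq_zero] at h1
    refine h1.resolve_left (mul_ne_zero (hitWeight_pos hK.pos).ne' ?_)
    simpa using hb.ne'
  have hlsc : LowerSemicontinuous H := by
    have hcomp : IsCompact ((fun x => G.kick⁻¹ * x) ⁻¹' K) :=
      (Homeomorph.mulLeft₀ G.kick⁻¹ (inv_ne_zero hb.ne')).isCompact_preimage.2 hK.isCompact
    have h1 := lowerSemicontinuous_measure_translate (volume.restrict A)
      Measure.restrict_le_self.absolutelyContinuous hcomp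
    have h2 := LowerSemicontinuous.comp h1 (g := fun u : ℝ => G.keep * u) (by fun_prop)
    convert h2 using 1
    funext u
    simp only [hH, Function.comp_apply, mem_preimage, div_eq_inv_mul]
  have hopen : IsOpen {u | 0 < H u} := hlsc.isOpen_preimage 0
  have hnull : μ {u | 0 < H u} = 0 := by
    rw [lintegral_eq_zero_iff hHm] at hμH
    refine measure_mono_null ?_ hμH
    intro u hu hcon
    exact (ne_of_gt hu) hcon
  have hzero : ∀ u, H u = 0 := by
    intro u
    by_contra hne
    have hu : u ∈ {u | 0 < H u} := pos_iff_ne_zero.2 hne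
    refine Measure.subset_compl_support_of_isOpen hopen hnull hu (hsupp ?_)
    have hm : MeasurableSet {y | (y - G.keep * u) / G.kick ∈ K} :=
      hS.preimage measurable_prodMk_left
    have hpos : 0 < volume ({y | (y - G.keep * u) / G.kick ∈ K} ∩ A) := by
      rw [← Measure.restrict_apply hm]
      exact hu
    obtain ⟨y, hy1, hy2⟩ := nonempty_of_measure_ne_zero hpos.ne'
    exact hI y (hAI hy2) u hy1
  have h3 := swap volume inferInstance
  simp only [hzero, lintegral_zero, volume_source, setLIntegral_const, mul_eq_zero] at h3
  refine h3.resolve_left fun h4 => ?_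
  have := volume_source_pos hK 0
  rw [volume_source, pos_iff_ne_zero] at this
  exact this (mul_eq_zero.2 h4)

/-- The sources of each y in I form a set of positive volume in the interior, hence of positive
μ-mass. This mass is lower semicontinuous in y and attains a positive minimum on the compact I. -/
theorem IsStationary.exists_mul_volume_le {μ : Measure ℝ} (hμ : G.IsStationary μ)
    (h : G.SingleReflection)
    (hvol : ∀ A, MeasurableSet A → A ⊆ Ioo (-G.Vbar) G.Vbar → μ A = 0 → volume A = 0)
    {I K : Set ℝ} {c : ℝ} (hK : G.IsCore K c) (hI : G.Reachable I K) (hIc : IsCompact I)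
    (hIn : I.Nonempty) (hIs : I ⊆ G.states) :
    ∃ k : ℝ≥0∞, 0 < k ∧ ∀ A, MeasurableSet A → A ⊆ I → k * volume A ≤ μ A := by
  have := hμ.1.1
  have hS := G.measurableSet_source hK.isCompact.measurableSet
  have hc : -(G.keep / G.kick) ≠ 0 := neg_ne_zero.2 (div_pos G.keep_pos G.kick_pos).ne'
  have hpos : ∀ y ∈ I, 0 < μ {u | (y - G.keep * u) / G.kick ∈ K} := by
    intro y hy
    rw [pos_iff_ne_zero]
    intro h0
    exact (volume_source_pos hK y).ne' (hvol _ (hS.preimage measurable_prodMk_right)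
      (fun u hu => hI y hy u hu) h0)
  have hlsc : LowerSemicontinuous fun y => μ {u | (y - G.keep * u) / G.kick ∈ K} := by
    have hcomp : IsCompact ((fun x => -(G.keep / G.kick) * x) ⁻¹' K) :=
      (Homeomorph.mulLeft₀ _ hc).isCompact_preimage.2 hK.isCompact
    have h1 := lowerSemicontinuous_measure_translate μ hμ.absolutelyContinuous hcomp
    have h2 := LowerSemicontinuous.comp h1 (g := fun y : ℝ => y / G.keep) (by fun_prop)
    convert h2 using 1
    funext y
    simp only [Function.comp_apply, mem_preimage]
    refine congrArg μ (Set.ext fun u => ?_)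
    have ha := G.keep_pos.ne'
    have hb := G.kick_pos.ne'
    rw [mem_ofPred_eq, mem_ofPred_eq,
      show -(G.keep / G.kick) * (u - y / G.keep) = (y - G.keep * u) / G.kick by
        field_simp; ring]
  obtain ⟨y₀, hy₀, hmin⟩ := (hlsc.lowerSemicontinuousOn I).exists_isMinOn hIn hIc
  refine ⟨G.hitWeight c * ENNReal.ofReal |G.kick⁻¹| *
    μ {u | (y₀ - G.keep * u) / G.kick ∈ K}, ?_, fun A hA hAI => ?_⟩
  · refine ENNReal.mul_pos (mul_ne_zero (hitWeight_pos hK.pos).ne' ?_) (hpos y₀ hy₀).ne'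
    simpa using G.kick_pos.ne'
  · refine le_trans ?_ (hμ.lintegral_source_le h hK hA (hAI.trans hIs))
    rw [mul_assoc _ (μ _), ← setLIntegral_const]
    exact mul_le_mul_right (setLIntegral_mono' hA fun y hy => hmin (hAI hy)) _

/-- The density of a stationary measure of a heavy piston is bounded below. -/
theorem IsStationary.exists_smul_volume_le {μ : Measure ℝ} (hμ : G.IsStationary μ)
    (h : G.SingleReflection) (hheavy : G.kick * G.vmax ≤ G.keep * G.Vbar) :
    ∃ k : ℝ, 0 < k ∧ ENNReal.ofReal k • volume.restrict (Ioo (-G.Vbar) G.Vbar) ≤ μ := by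
  have hsupp := hμ.Ioo_subset_support h hheavy
  obtain ⟨K, c, hK, hKmin⟩ := G.exists_isCore_left
  obtain ⟨K', c', hK', hKmin'⟩ := G.exists_isCore_right
  have ha := G.keep_pos
  have hb := G.kick_pos
  have hab := G.keep_add_kick
  have hV := G.Vbar_pos
  have hbV : G.kick * G.Vbar < G.kick * G.vmin := mul_lt_mul_of_pos_left G.Vbar_lt_vmin hb
  have hsum : G.keep * G.Vbar + G.kick * G.Vbar = G.Vbar := by rw [← add_mul, hab, one_mul]
  -- Atoms faster than `Vbar` put the source below `Vbar`; heaviness keeps it above `-Vbar` when y ≥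
  -- 0. Negative y are served by atoms from the right.
  have hI : G.Reachable (Icc 0 G.Vbar) K := by
    intro y hy u hu
    have h1 := hKmin _ hu
    have h2 := (le_abs_self _).trans_lt (hK.abs_lt _ hu)
    rw [lt_div_iff₀ hb] at h1
    rw [div_lt_iff₀ hb] at h2
    constructor
    · refine lt_of_mul_lt_mul_left ?_ ha.le
      linarith [hy.1]
    · refine lt_of_mul_lt_mul_left ?_ ha.le
      linarith [hy.2]
  have hI' : G.Reachable (Icc (-G.Vbar) 0) K' := by
    intro y hy u hu
    have h1 := hKmin' _ hu
    have h2 := (neg_lt_of_abs_lt (hK'.abs_lt _ hu))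
    rw [div_lt_iff₀ hb] at h1
    rw [lt_div_iff₀ hb] at h2
    constructor
    · refine lt_of_mul_lt_mul_left ?_ ha.le
      linarith [hy.1]
    · refine lt_of_mul_lt_mul_left ?_ ha.le
      linarith [hy.2]
  have hIs : Icc 0 G.Vbar ⊆ G.states := Icc_subset_Icc_left (by linarith)
  have hIs' : Icc (-G.Vbar) 0 ⊆ G.states := Icc_subset_Icc_right hV.le
  have hsplit : ∀ A : Set ℝ, A ⊆ Ioo (-G.Vbar) G.Vbar →
      A ∩ Ici 0 ⊆ Icc 0 G.Vbar ∧ A \ Ici 0 ⊆ Icc (-G.Vbar) 0 := by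
    intro A hA
    exact ⟨fun x hx => ⟨hx.2, (hA hx.1).2.le⟩,
      fun x hx => ⟨(hA hx.1).1.le, (not_le.1 hx.2).le⟩⟩
  -- Both halves are settled here before either lower bound, since the sources of points in one half
  -- may lie in the other.
  have hvol : ∀ A, MeasurableSet A → A ⊆ Ioo (-G.Vbar) G.Vbar → μ A = 0 → volume A = 0 := by
    intro A hA hAs hA0
    obtain ⟨hA1, hA2⟩ := hsplit A hAs
    rw [← measure_inter_add_sdiff A (measurableSet_Ici (a := (0 : ℝ))),
      hμ.volume_eq_zero h hsupp hK hI (hA.inter measurableSet_Ici) (hA1.trans hIs) hA1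
        (measure_mono_null inter_subset_left hA0),
      hμ.volume_eq_zero h hsupp hK' hI' (hA.diff measurableSet_Ici) (hA2.trans hIs') hA2
        (measure_mono_null sdiff_subset hA0), add_zero]
  obtain ⟨k, hk, hle⟩ := hμ.exists_mul_volume_le h hvol hK hI isCompact_Icc
    (nonempty_Icc.2 hV.le) hIs
  obtain ⟨k', hk', hle'⟩ := hμ.exists_mul_volume_le h hvol hK' hI' isCompact_Icc
    (nonempty_Icc.2 (by linarith)) hIs'
  obtain ⟨e, he, hek⟩ := ENNReal.lt_iff_exists_nnreal_btwn.1 (lt_min hk hk')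
  refine ⟨e, by exact_mod_cast he, ?_⟩
  rw [ENNReal.ofReal_coe_nnreal]
  refine Measure.le_iff.2 fun A hA => ?_
  have hB : MeasurableSet (A ∩ Ioo (-G.Vbar) G.Vbar) := hA.inter measurableSet_Ioo
  obtain ⟨hB1, hB2⟩ := hsplit _ (inter_subset_right (s := A))
  rw [Measure.smul_apply, smul_eq_mul, Measure.restrict_apply hA]
  refine le_trans ?_ (measure_mono (inter_subset_left (s := A) (t := Ioo (-G.Vbar) G.Vbar)))
  rw [← measure_inter_add_sdiff (μ := volume) _ (measurableSet_Ici (a := (0 : ℝ))),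
    ← measure_inter_add_sdiff (μ := μ) _ (measurableSet_Ici (a := (0 : ℝ))), mul_add]
  refine add_le_add ((mul_le_mul_left (hek.le.trans (min_le_left _ _)) _).trans
      (hle _ (hB.inter measurableSet_Ici) hB1))
    ((mul_le_mul_left (hek.le.trans (min_le_right _ _)) _).trans
      (hle' _ (hB.diff measurableSet_Ici) hB2))

theorem IsStationary.absolutelyContinuous_restrict {μ : Measure ℝ} (hμ : G.IsStationary μ) :
    μ ≪ volume.restrict (Ioo (-G.Vbar) G.Vbar) := by
  refine Measure.AbsolutelyContinuous.mk fun A hA hA0 => ?_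
  rw [Measure.restrict_apply hA] at hA0
  refine measure_mono_null (t := G.statesᶜ ∪ (A ∩ Ioo (-G.Vbar) G.Vbar ∪ {-G.Vbar, G.Vbar})) ?_
    (measure_union_null hμ.1.2 (hμ.absolutelyContinuous (measure_union_null hA0
      ((Set.toFinite _).measure_zero volume))))
  intro z hz
  by_cases hzs : z ∈ G.states
  · right
    rcases hzs.1.eq_or_lt with h1 | h1
    · right; left; exact h1.symm
    rcases hzs.2.eq_or_lt with h2 | h2
    · right; right; exact h2
    · left; exact ⟨hz, h1, h2⟩
  · exact Or.inl hzs

/-! ### Convergence of arbitrary initial laws and uniqueness -/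

theorem Mixing.evolve_sub_le {C γ : ℝ} (hmix : G.Mixing C γ) (h : G.SingleReflection)
    (hC : 0 ≤ C) {μ₀ : Measure ℝ} [IsProbabilityMeasure μ₀]
    (happ : ∀ A, MeasurableSet A → μ₀ A = G.limExpect (A.indicator 1)) {ν : Measure ℝ}
    (hν : G.IsDistribution ν) {t : ℝ} (ht : 0 ≤ t) {A : Set ℝ} (hA : MeasurableSet A) :
    |(G.evolve ν t A).toReal - (μ₀ A).toReal| ≤ C * Real.exp (-γ * t) := by
  have := hν.1
  set d := C * Real.exp (-γ * t) with hd
  have hd0 : 0 ≤ d := mul_nonneg hC (Real.exp_nonneg _)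
  have hae : ∀ᵐ u ∂ν, u ∈ G.states := by
    filter_upwards [measure_eq_zero_iff_ae_notMem.1 hν.2] with u hu using not_not.1 hu
  have hm := measurable_indicator_one hA
  have hone : ∀ w ∈ G.states, A.indicator (1 : ℝ → ℝ≥0∞) w ≤ 1 := fun w _ => indicator_one_le A w
  have h1 : G.evolve ν t A ≤ μ₀ A + ENNReal.ofReal d := by
    calc G.evolve ν t A ≤ ∫⁻ _, (μ₀ A + ENNReal.ofReal d) ∂ν := by
          refine lintegral_mono_ae ?_
          filter_upwards [hae] with u hu
          rw [trans_eq, happ A hA]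
          exact hmix.expect_le_limExpect h hm hone ht hu
      _ = _ := by simp
  have h2 : μ₀ A ≤ G.evolve ν t A + ENNReal.ofReal d := by
    calc μ₀ A = ∫⁻ _, μ₀ A ∂ν := by simp
      _ ≤ ∫⁻ u, (G.trans t u A + ENNReal.ofReal d) ∂ν := by
          refine lintegral_mono_ae ?_
          filter_upwards [hae] with u hu
          rw [trans_eq, happ A hA]
          exact hmix.limExpect_le_expect h hm hone ht hu
      _ = _ := by
          rw [lintegral_add_right _ measurable_const]
          simp [evolve]
  have hμt : μ₀ A ≠ ⊤ := measure_ne_top μ₀ A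
  have het : G.evolve ν t A ≠ ⊤ := ne_top_of_le_ne_top (by finiteness) h1
  have h1' := ENNReal.toReal_mono (by finiteness) h1
  have h2' := ENNReal.toReal_mono (by finiteness) h2
  rw [ENNReal.toReal_add hμt ENNReal.ofReal_ne_top, ENNReal.toReal_ofReal hd0] at h1'
  rw [ENNReal.toReal_add het ENNReal.ofReal_ne_top, ENNReal.toReal_ofReal hd0] at h2'
  rw [abs_le]
  constructor <;> linarith

theorem SingleReflection.evolve_univ (h : G.SingleReflection) {ν : Measure ℝ}
    (hν : G.IsDistribution ν) {t : ℝ} (ht : 0 ≤ t) : G.evolve ν t univ = 1 := by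
  have := hν.1
  have : G.evolve ν t univ = ∫⁻ _, 1 ∂ν := by
    refine lintegral_congr_ae ?_
    filter_upwards [measure_eq_zero_iff_ae_notMem.1 hν.2] with u hu
    rw [trans_eq, indicator_univ]
    exact h.expect_one ht (not_not.1 hu)
  rw [this]
  simp

theorem IsPistonVelocity.isDistribution {Ω : Type*} [MeasurableSpace Ω] {ℙ : Measure Ω}
    [IsProbabilityMeasure ℙ] {W : ℝ → Ω → ℝ} (hW : G.IsPistonVelocity ℙ W) :
    G.IsDistribution (ℙ.map (W 0)) := by
  have hm := hW.measurable 0 le_rfl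
  have hs : MeasurableSet G.states := measurableSet_Icc
  refine ⟨Measure.isProbabilityMeasure_map hm.aemeasurable, ?_⟩
  rw [Measure.map_apply hm hs.compl]
  exact hW.start

theorem IsPistonVelocity.measure_preimage {Ω : Type*} [MeasurableSpace Ω] {ℙ : Measure Ω}
    {W : ℝ → Ω → ℝ} (hW : G.IsPistonVelocity ℙ W) {t : ℝ} (ht : 0 ≤ t) {A : Set ℝ}
    (hA : MeasurableSet A) : ℙ (W t ⁻¹' A) = G.evolve (ℙ.map (W 0)) t A := by
  have hmeas : Measurable fun u => G.trans t u A := by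
    simp only [trans_eq]
    exact G.measurable_expect (measurable_indicator_one hA) t
  have h1 := hW.markov 0 t le_rfl ht A hA univ MeasurableSet.univ
  rw [univ_inter, zero_add, Measure.restrict_univ] at h1
  rw [h1, evolve, lintegral_map hmeas (hW.measurable 0 le_rfl)]

/-- A stationary law does not move, yet it approaches μ₀ as time grows. -/
theorem Mixing.stationary_unique {C γ : ℝ} (hmix : G.Mixing C γ) (h : G.SingleReflection)
    (hC : 0 ≤ C) (hγ : 0 < γ) {μ₀ : Measure ℝ} [IsProbabilityMeasure μ₀]
    (happ : ∀ A, MeasurableSet A → μ₀ A = G.limExpect (A.indicator 1)) {μ : Measure ℝ}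
    (hμ : G.IsStationary μ) : μ = μ₀ := by
  have := hμ.1.1
  refine Measure.ext fun A hA => ?_
  rw [← ENNReal.toReal_eq_toReal_iff' (measure_ne_top μ A) (measure_ne_top μ₀ A), ← sub_eq_zero,
    ← abs_nonpos_iff]
  have hlim : Filter.Tendsto (fun t : ℝ => C * Real.exp (-γ * t)) Filter.atTop (nhds (C * 0)) :=
    Filter.Tendsto.const_mul C (Real.tendsto_exp_atBot.comp
      (Filter.tendsto_id.const_mul_atTop_of_neg (neg_neg_of_pos hγ)))
  rw [mul_zero] at hlim
  refine ge_of_tendsto hlim ?_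
  filter_upwards [Filter.eventually_ge_atTop 0] with t ht
  rw [← hμ.2 t ht A hA]
  exact hmix.evolve_sub_le h hC happ hμ.1 ht hA

end PistonModel

end

theorem mainTheorem3 (G : PistonModel)
    (hreflect : (G.M - G.m) / (G.M + G.m) * G.Vbar + 2 * G.m / (G.M + G.m) * G.vmax
      ≤ 3 * G.Vbar) :
    ∃ μ₀ : Measure ℝ,
      -- `μ₀` is the unique stationary measure
      G.IsStationary μ₀ ∧ (∀ μ : Measure ℝ, G.IsStationary μ → μ = μ₀) ∧
      -- it is absolutely continuous, and its density is bounded below for a heavy piston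
      (∃ f₀ : ℝ → ℝ≥0∞, Measurable f₀ ∧
        μ₀ = (volume.restrict (Ioo (-G.Vbar) G.Vbar)).withDensity f₀ ∧
        (2 * G.m * G.vmax ≤ (G.M - G.m) * G.Vbar →
          ∃ c : ℝ, 0 < c ∧ ∀ w ∈ Ioo (-G.Vbar) G.Vbar, ENNReal.ofReal c ≤ f₀ w)) ∧
      -- every initial distribution converges to it, uniformly and exponentially fast
      ∃ C γ : ℝ, 0 < C ∧ 0 < γ ∧
        (∀ ν : Measure ℝ, G.IsDistribution ν → ∀ t : ℝ, 0 ≤ t → G.evolve ν t univ = 1 ∧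
          ∀ A : Set ℝ, MeasurableSet A →
          |(G.evolve ν t A).toReal - (μ₀ A).toReal| ≤ C * Real.exp (-γ * t)) ∧
        (∀ (Ω : Type*) [MeasurableSpace Ω] (ℙ : Measure Ω) [IsProbabilityMeasure ℙ]
          (W : ℝ → Ω → ℝ), G.IsPistonVelocity ℙ W → ∀ t : ℝ, 0 ≤ t → ∀ A : Set ℝ,
          MeasurableSet A →
          |(ℙ (W t ⁻¹' A)).toReal - (μ₀ A).toReal| ≤ C * Real.exp (-γ * t)) := by
  have h : G.SingleReflection := hreflect
  obtain ⟨C, γ, hC, hγ, hmix⟩ := h.exists_mixing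
  obtain ⟨μ₀, hμ₀, happ⟩ := hmix.exists_stationary h hγ
  have hprob := hμ₀.1.1
  have hac := hμ₀.absolutelyContinuous_restrict
  refine ⟨μ₀, hμ₀, fun μ hμ => hmix.stationary_unique h hC.le hγ happ hμ, ?_, C, γ, hC, hγ, ?_, ?_⟩
  · by_cases hheavy : 2 * G.m * G.vmax ≤ (G.M - G.m) * G.Vbar
    · have hheavy' : G.kick * G.vmax ≤ G.keep * G.Vbar := by
        unfold PistonModel.kick PistonModel.keep
        rw [div_mul_eq_mul_div, div_mul_eq_mul_div]
        exact div_le_div_of_nonneg_right hheavy (by linarith [G.m_pos, G.m_lt_M])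
      obtain ⟨k, hk, hle⟩ := hμ₀.exists_smul_volume_le h hheavy'
      obtain ⟨f, hf, hμf, hkf⟩ := exists_density_ge hac ENNReal.ofReal_ne_top hle
      exact ⟨f, hf, hμf, fun _ => ⟨k, hk, fun w _ => hkf w⟩⟩
    · exact ⟨_, Measure.measurable_rnDeriv _ _, (Measure.withDensity_rnDeriv_eq _ _ hac).symm,
        fun hh => absurd hh hheavy⟩
  · intro ν hν t ht
    exact ⟨h.evolve_univ hν ht, fun A hA => hmix.evolve_sub_le h hC.le happ hν ht hA⟩
  · intro Ω _ ℙ _ W hW t ht A hA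
    rw [hW.measure_preimage ht hA]
    exact hmix.evolve_sub_le h hC.le happ hW.isDistribution ht hA
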